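/- Let $\mathbb{D}$ be the open unit disk, let $\mathbb{T}$ be the unit circle, and let $H(\mathbb{D})$ be the Fréchet space of holomorphic functions on $\mathbb{D}$ with the topology of uniform convergence on compact subsets. For an automorphism (biholomorphic self-map) $\varphi$ of $\mathbb{D}$, let $C_\varphi f=f\circ\varphi$ be the composition operator on $H(\mathbb{D})$. A vector $f$ is hypercyclic for $C_\varphi$ if its orbit $\{C_\varphi^n f : n\ge 1\}$ is dense in $H(\mathbb{D})$. A point $\omega\in\mathbb{T}$ is the attractive fixed point of $\varphi$ if $\varphi(z)\to\omega$ as $z\to\omega$ in $\mathbb{D}$, and the iterates $\varphi^n(z)=(\varphi\circ\cdots\circ\varphi)(z)$ converge to $\omega$ for every $z\in\mathbb{D}$; such a $\varphi$ may be parabolic or hyperbolic. **Theorem.** Let $\omega\in\mathbb{T}$. There exists $f\in H(\mathbb{D})$ that is hypercyclic for every composition operator $C_\varphi$, where $\varphi$ runs over all automorphisms of $\mathbb{D}$ that have $\omega$ as attractive fixed point. Moreover, the set of all such common hypercyclic vectors $f$ is residual in $H(\mathbb{D})$, that is, it contains a countable intersection of dense open subsets of $H(\mathbb{D})$. -/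

import Mathlib

open Filter Topology
open scoped Complex.UnitDisc

noncomputable section

/-- A function on the open unit disc is holomorphic if it is the restriction of a function that is
complex differentiable on the open unit disc. -/
def IsHolomorphicOnDisc (f : 𝔻 → ℂ) : Prop :=
  ∃ F : ℂ → ℂ, DifferentiableOn ℂ F (Metric.ball 0 1) ∧ ∀ z : 𝔻, F z = f z

theorem IsHolomorphicOnDisc.comp {f : 𝔻 → ℂ} {φ : 𝔻 → 𝔻} (hf : IsHolomorphicOnDisc f)
    (hφ : IsHolomorphicOnDisc (fun z => (φ z : ℂ))) : IsHolomorphicOnDisc (fun z => f (φ z)) := by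
  obtain ⟨F, hF, hFf⟩ := hf
  obtain ⟨G, hG, hGφ⟩ := hφ
  refine ⟨F ∘ G, hF.comp hG ?_, fun z => ?_⟩
  · intro z hz
    have h := hGφ (Complex.UnitDisc.mk z (mem_ball_zero_iff.1 hz))
    rw [Complex.UnitDisc.coe_mk] at h
    rw [h]
    exact mem_ball_zero_iff.2 (Complex.UnitDisc.norm_lt_one _)
  · simp only [Function.comp_apply, hGφ, hFf]

/-- The space `H(𝔻)` of holomorphic functions on the open unit disc, as a complex vector space
with the topology of uniform convergence on compact subsets (the compact-open topology that it
inherits from the space of continuous functions). -/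
def HolDisc : Submodule ℂ C(𝔻, ℂ) where
  carrier := {f | IsHolomorphicOnDisc f}
  add_mem' := by
    rintro f g ⟨F, hF, hFf⟩ ⟨G, hG, hGg⟩
    exact ⟨F + G, hF.add hG, fun z => by simp [hFf, hGg]⟩
  zero_mem' := ⟨0, differentiableOn_const 0, fun z => rfl⟩
  smul_mem' := by
    rintro c f ⟨F, hF, hFf⟩
    exact ⟨c • F, hF.const_smul c, fun z => by simp [hFf]⟩

/-- An automorphism of the unit disc: a biholomorphic map of `𝔻` onto itself. -/
structure DiscAut where
  /-- the underlying bijection -/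
  toHomeomorph : 𝔻 ≃ₜ 𝔻
  holomorphic : IsHolomorphicOnDisc (fun z => (toHomeomorph z : ℂ))
  holomorphic_symm : IsHolomorphicOnDisc (fun z => (toHomeomorph.symm z : ℂ))

/-- The point `ω` is an attractive fixed point, on the unit circle, of the automorphism `φ`:
`φ` extends to `ω` continuously with value `ω`, and the orbit under `φ` of every point of the
disc converges to `ω`. -/
def DiscAut.HasAttractiveFixedPoint (φ : DiscAut) (ω : Circle) : Prop :=
  Tendsto (fun z : 𝔻 => (φ.toHomeomorph z : ℂ)) (comap (fun z : 𝔻 => (z : ℂ)) (𝓝 (ω : ℂ)))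
      (𝓝 (ω : ℂ)) ∧
    ∀ z : 𝔻, Tendsto (fun n : ℕ => ((φ.toHomeomorph^[n] z : 𝔻) : ℂ)) atTop (𝓝 (ω : ℂ))

/-- The composition operator `C_φ f = f ∘ φ`, a continuous linear operator on `H(𝔻)`. -/
def DiscAut.compOp (φ : DiscAut) : HolDisc →L[ℂ] HolDisc where
  toFun f := ⟨f.1.comp ⟨φ.toHomeomorph, φ.toHomeomorph.continuous⟩, f.2.comp φ.holomorphic⟩
  map_add' _ _ := rfl
  map_smul' _ _ := rfl
  cont := ((ContinuousMap.continuous_precomp _).comp continuous_subtype_val).subtype_mk _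

/-- The set `HC(T)` of hypercyclic vectors of a continuous operator `T` on a topological vector
space: the vectors `x` whose orbit `{T ^ n x : n ≥ 1}` is dense. -/
def hypercyclicVectors {X : Type*} [AddCommGroup X] [Module ℂ X] [TopologicalSpace X]
    (T : X →L[ℂ] X) : Set X :=
  {x | Dense {y : X | ∃ n : ℕ, 1 ≤ n ∧ y = (T ^ n) x}}

/-- The common hypercyclic vectors in `H(𝔻)` of all the composition operators `C_φ`, where `φ` is
an automorphism of the disc with attractive fixed point `ω`. -/
def commonHypercyclicVectors (ω : Circle) : Set HolDisc :=
  {f | ∀ φ : DiscAut, φ.HasAttractiveFixedPoint ω → f ∈ hypercyclicVectors φ.compOp}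

end

/-! The Cayley transform sending `ω` to infinity turns the automorphisms fixing `ω` into the maps `w
↦ a w + b` with `a > 0` and `b` real. Attraction to `ω` leaves `a > 1`, or `a = 1` and `b ≠ 0`.
Hence the iterates of `φ` are the times `n t` of a flow: a translation flow in one of two
directions, or the dilation flow from a real point `-c`, where `t = log a`.

The parameters `(t, c)` are uncountable, so Baire's theorem is applied to compact pieces of the
parameter space. On such a piece, being sent into an open set `V` by some iterate for every
parameter is an open condition on `f`, and countably many pieces suffice
(`setOf_forall_dense_mem_residual`). What remains is density: near a given `h`, find one `f` serving
all parameters close to a given one.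

Take `f = h + ∑ S (s i)`, where `S r` is nearly the target `g` carried back by time `r`. By
`exists_separated_approximations`, finitely many times `s i` suffice for a whole interval of `t`:
some `n t` is close to one `s i` and so far from the others that the inverse squares of the
distances have a small sum. The error terms obey such inverse-square bounds because functions
vanishing to second order at `ω` are dense (`HolDisc.dense_setOf_isBigO_sq`); on the half-plane this
is quadratic decay. For dilations `g` must also be made to vanish at the repelling point
(`vanishingAt`). -/

/-! ### A Baire category criterion and the choice of times -/

/-- A criterion for the common universality of a parametrised family of sequences of maps. -/
theorem setOf_forall_dense_mem_residual {X P : Type*} [TopologicalSpace X]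
    [SecondCountableTopology X] [TopologicalSpace P] [SecondCountableTopology P]
    [LocallyCompactSpace P] (T : ℕ → P → X → X)
    (hT : ∀ n, Continuous fun a : P × X => T n a.1 a.2)
    (H : ∀ V : Set X, IsOpen V → V.Nonempty → ∀ p, ∃ Λ ∈ 𝓝 p, ∀ W : Set X, IsOpen W →
      W.Nonempty → ∃ f ∈ W, ∀ q ∈ Λ, ∃ n, 1 ≤ n ∧ T n q f ∈ V) :
    {f | ∀ p, Dense {y | ∃ n, 1 ≤ n ∧ y = T n p f}} ∈ residual X := by
  have key : ∀ V ∈ TopologicalSpace.countableBasis X,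
      {f | ∀ p, ∃ n, 1 ≤ n ∧ T n p f ∈ V} ∈ residual X := by
    intro V hV
    have hVo := TopologicalSpace.isOpen_of_mem_countableBasis hV
    choose Λ hΛ hd using H V hVo (TopologicalSpace.nonempty_of_mem_countableBasis hV)
    -- Compactness makes the condition on `f` open; second countability reduces the cover to
    -- countably many pieces.
    choose C hC hCΛ hCc using fun p => local_compact_nhds (hΛ p)
    obtain ⟨s, hs, hcov⟩ := TopologicalSpace.countable_cover_nhds hC
    have hres : ∀ p, {f | ∀ q ∈ C p, ∃ n, 1 ≤ n ∧ T n q f ∈ V} ∈ residual X := by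
      intro p
      apply residual_of_dense_open
      · rw [isOpen_iff_mem_nhds]
        intro f hf
        refine (hCc p).eventually_forall_of_forall_eventually fun q hq => ?_
        obtain ⟨n, hn, hm⟩ := hf q hq
        have h1 : ∀ᶠ z : X × P in 𝓝 (f, q), T n z.2 z.1 ∈ V :=
          ((hT n).comp continuous_swap).continuousAt.eventually (hVo.mem_nhds hm)
        filter_upwards [h1] with z hz
        exact ⟨n, hn, hz⟩
      · rw [dense_iff_inter_open]
        intro W hW hWne
        obtain ⟨f, hfW, hf⟩ := hd p W hW hWne
        exact ⟨f, hfW, fun q hq => hf q (hCΛ p hq)⟩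
    filter_upwards [(countable_bInter_mem hs).2 fun p _ => hres p] with f hf p
    obtain ⟨r, hr, hpr⟩ := Set.mem_iUnion₂.1 (hcov.symm ▸ Set.mem_univ p : p ∈ ⋃ x ∈ s, C x)
    exact Set.mem_iInter₂.1 hf r hr p hpr
  filter_upwards [(countable_bInter_mem (TopologicalSpace.countable_countableBasis X)).2 key]
    with f hf p
  rw [(TopologicalSpace.isBasis_countableBasis X).dense_iff]
  intro V hV _
  obtain ⟨n, hn, hm⟩ := Set.mem_iInter₂.1 hf V hV p
  exact ⟨_, hm, n, hn, rfl⟩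

/-- Separated positive numbers `s i` such that every half-line `t, 2t, 3t, …` with `t` in a given
interval comes close to one of them, and stays far away from all the others. -/
theorem exists_separated_approximations {t₁ t₂ δ η : ℝ} (ht₁ : 0 < t₁) (hδ : 0 < δ) (hη : 0 < η) :
    ∃ (m : ℕ) (s : ℕ → ℝ), (∀ i, 0 < s i) ∧ ∑ i ∈ Finset.range m, 1 / s i ^ 2 ≤ η ∧
      ∀ t ∈ Set.Icc t₁ t₂, ∃ n : ℕ, 1 ≤ n ∧ 1 / (n * t) ^ 2 ≤ η ∧ ∃ i ∈ Finset.range m,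
        |n * t - s i| ≤ δ ∧ (∀ j ∈ (Finset.range m).erase i, n * t ≠ s j) ∧
        ∑ j ∈ (Finset.range m).erase i, 1 / (n * t - s j) ^ 2 ≤ η := by
  have hsum : Summable fun k : ℤ => 1 / (k : ℝ) ^ 2 := Real.summable_one_div_int_pow.2 one_lt_two
  set Z : ℝ := ∑' k : ℤ, 1 / (k : ℝ) ^ 2
  have hZ : ∀ (J : Finset ℕ) (i : ℤ), ∑ j ∈ J, 1 / ((i - j : ℤ) : ℝ) ^ 2 ≤ Z := by
    intro J i
    have := hsum.sum_le_tsum (J.image fun j : ℕ => i - (j : ℤ)) (fun k _ => by positivity)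
    rwa [Finset.sum_image (fun a _ b _ h => by simpa using h)] at this
  have hZ1 : 1 ≤ Z := by simpa using hZ {0} 1
  -- Points with gaps at least `N * t₁ * |i - j|` have inverse-square sum at most `Z / (N * t₁) ^
  -- 2`; `N > 1` allows bounding `N` by `N ^ 2`.
  obtain ⟨N, hN⟩ := exists_nat_gt (max 1 (Z / (t₁ ^ 2 * η)))
  have hN1 : (1 : ℝ) < N := (le_max_left _ _).trans_lt hN
  have hNη : Z / (N * t₁) ^ 2 ≤ η := by
    have h1 : Z / (t₁ ^ 2 * η) < N := (le_max_right _ _).trans_lt hN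
    rw [div_lt_iff₀ (by positivity)] at h1
    rw [div_le_iff₀ (by positivity)]
    nlinarith [mul_pos (pow_pos ht₁ 2) hη]
  have hbound : ∀ (J : Finset ℕ) (i : ℤ) (x : ℕ → ℝ),
      (∀ j ∈ J, N * t₁ * |((i - j : ℤ) : ℝ)| ≤ |x j|) → (∀ j ∈ J, i ≠ j) →
      ∑ j ∈ J, 1 / x j ^ 2 ≤ η := by
    intro J i x hx hij
    refine le_trans ?_ hNη
    rw [div_eq_mul_inv, mul_comm]
    refine le_trans ?_ (mul_le_mul_of_nonneg_left (hZ J i) (by positivity))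
    rw [Finset.mul_sum]
    refine Finset.sum_le_sum fun j hj => ?_
    have h0 : ((i - j : ℤ) : ℝ) ≠ 0 := Int.cast_ne_zero.2 (sub_ne_zero.2 (hij j hj))
    have h1 := hx j hj
    have h2 : (0 : ℝ) < N * t₁ * |((i - j : ℤ) : ℝ)| := by positivity
    rw [← sq_abs (x j), ← sq_abs ((i - j : ℤ) : ℝ), mul_one_div, ← one_div, div_div, ← mul_pow]
    gcongr
  -- The `i`-th step `δ / (N * (i + 1))` is the largest that multiplication by `n = N * (i + 1)`
  -- keeps within `δ`. The harmonic series diverges, so finitely many steps cover the interval.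
  set τ : ℕ → ℝ := fun i => t₁ + δ / N * ∑ l ∈ Finset.range i, 1 / ((l : ℝ) + 1) with hτ
  have hτ_succ : ∀ i, τ (i + 1) = τ i + δ / (N * (i + 1)) := by
    intro i
    simp only [hτ, Finset.sum_range_succ]
    field_simp
    ring
  have hτ_mono : Monotone τ := monotone_nat_of_le_succ fun i => by
    rw [hτ_succ]
    have : 0 ≤ δ / (N * (i + 1)) := by positivity
    linarith
  have hτ₀ : τ 0 = t₁ := by simp [hτ]
  have hτ₁ : ∀ i, t₁ ≤ τ i := fun i => hτ₀ ▸ hτ_mono (Nat.zero_le i)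
  have hτ_top : Tendsto τ atTop atTop :=
    tendsto_atTop_add_const_left _ _
      (Real.tendsto_sum_range_one_div_nat_succ_atTop.const_mul_atTop (by positivity))
  obtain ⟨m, hm⟩ := (hτ_top.eventually_gt_atTop t₂).exists
  refine ⟨m, fun i => N * (i + 1) * τ i, fun i => ?_, ?_, fun t ht => ?_⟩
  · have := ht₁.trans_le (hτ₁ i)
    positivity
  -- The index `-1` stands for time `0`: `s j ≥ N * t₁ * (j + 1)`.
  · refine hbound _ (-1) _ (fun j _ => ?_) (fun j _ => by omega)
    have := ht₁.trans_le (hτ₁ j)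
    rw [abs_of_nonneg (by positivity : (0 : ℝ) ≤ N * (j + 1) * τ j)]
    have h1 : |((-1 - j : ℤ) : ℝ)| = j + 1 := by
      push_cast
      rw [abs_of_neg (by linarith [(Nat.cast_nonneg j : (0 : ℝ) ≤ j)])]
      ring
    rw [h1]
    nlinarith [mul_le_mul_of_nonneg_left (hτ₁ j) (by positivity : (0 : ℝ) ≤ N * (j + 1))]
  · have hex : ∃ k, t < τ k := ⟨m, ht.2.trans_lt hm⟩
    obtain ⟨i, hi⟩ : ∃ i, Nat.find hex = i + 1 := Nat.exists_eq_succ_of_ne_zero fun h0 => by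
      have := Nat.find_spec hex
      rw [h0, hτ₀] at this
      exact this.not_ge ht.1
    have hti : t < τ (i + 1) := hi ▸ Nat.find_spec hex
    have hit : τ i ≤ t := not_lt.1 (Nat.find_min hex (by omega))
    have him : i < m := by
      have := Nat.find_min' hex (ht.2.trans_lt hm)
      omega
    have htpos : 0 < t := ht₁.trans_le ht.1
    -- Since `τ` is monotone, the multiplier and the base time differ in the same direction, so the
    -- two differences cannot cancel.
    have hfar : ∀ j : ℕ, j ≠ i → N * t₁ * |((i - j : ℤ) : ℝ)| ≤
        |((N * (i + 1) : ℕ) : ℝ) * t - N * (j + 1) * τ j| := by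
      intro j hj
      push_cast
      rcases lt_or_gt_of_ne hj with hlt | hgt
      · have h1 : (j : ℝ) < i := by exact_mod_cast hlt
        have h2 : τ j ≤ t := (hτ_mono hlt.le).trans hit
        rw [abs_of_pos (by linarith)]
        refine le_trans ?_ (le_abs_self _)
        have h3 : (N : ℝ) * (j + 1) * τ j ≤ N * (j + 1) * t := by gcongr
        have h4 : N * (i - j) * t₁ ≤ N * (i - j : ℝ) * t :=
          mul_le_mul_of_nonneg_left ht.1 (mul_nonneg (by positivity) (by linarith))
        nlinarith
      · have h1 : (i : ℝ) < j := by exact_mod_cast hgt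
        have h2 : t ≤ τ j := hti.le.trans (hτ_mono hgt)
        rw [abs_of_neg (by linarith), abs_sub_comm]
        refine le_trans ?_ (le_abs_self _)
        have h3 : (N : ℝ) * (i + 1) * t ≤ N * (i + 1) * τ j := by gcongr
        have h4 : N * (j - i) * t₁ ≤ N * (j - i : ℝ) * τ j :=
          mul_le_mul_of_nonneg_left (hτ₁ j) (mul_nonneg (by positivity) (by linarith))
        nlinarith
    have hN0 : 0 < N := by exact_mod_cast zero_lt_one.trans hN1
    refine ⟨N * (i + 1), Nat.one_le_iff_ne_zero.2 (by positivity), ?_, i, Finset.mem_range.2 him,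
      ?_, ?_, ?_⟩
    · refine le_trans ?_ hNη
      refine div_le_div₀ (by linarith) hZ1 (by positivity) ?_
      push_cast
      refine pow_le_pow_left₀ (by positivity) (mul_le_mul ?_ ht.1 ht₁.le (by positivity)) 2
      nlinarith [(Nat.cast_nonneg i : (0 : ℝ) ≤ i)]
    · have h1 : t - τ i ≤ δ / (N * (i + 1)) := by linarith [hτ_succ i]
      rw [le_div_iff₀ (by positivity)] at h1
      push_cast
      rw [← mul_sub, abs_of_nonneg (mul_nonneg (by positivity) (by linarith))]
      linarith
    · intro j hj h
      have h0 : (i - j : ℤ) ≠ 0 := by have := Finset.ne_of_mem_erase hj; omega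
      have h1 := hfar j (Finset.ne_of_mem_erase hj)
      rw [sub_eq_zero.2 h, abs_zero] at h1
      have : (0 : ℝ) < N * t₁ * |((i - j : ℤ) : ℝ)| := by
        have : ((i - j : ℤ) : ℝ) ≠ 0 := Int.cast_ne_zero.2 h0
        positivity
      linarith
    · refine hbound _ i _ (fun j hj => hfar j (Finset.ne_of_mem_erase hj)) fun j hj => ?_
      have := Finset.ne_of_mem_erase hj
      omega

/-! ### The Baire space of holomorphic functions and a dense subset -/

instance : LocallyCompactSpace 𝔻 :=
  Metric.isOpen_ball.locallyCompactSpace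

instance : SecondCountableTopology 𝔻 :=
  inferInstanceAs (SecondCountableTopology (Metric.ball (0 : ℂ) 1))

namespace HolDisc

instance : SecondCountableTopology HolDisc :=
  Topology.IsEmbedding.subtypeVal.secondCountableTopology

theorem exists_unitDisc_eq {z : ℂ} (hz : z ∈ Metric.ball (0 : ℂ) 1) : ∃ w : 𝔻, (w : ℂ) = z :=
  ⟨Complex.UnitDisc.mk z (mem_ball_zero_iff.1 hz), Complex.UnitDisc.coe_mk _ _⟩

/-- Weierstrass: locally uniform limits of holomorphic functions are holomorphic. This gives
completeness, hence the Baire property. -/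
theorem isClosed_coe : IsClosed (HolDisc : Set C(𝔻, ℂ)) := by
  rw [isClosed_iff_clusterPt]
  intro f hf
  have hnb : (𝓝[(HolDisc : Set C(𝔻, ℂ))] f).NeBot := hf.neBot.mono (by rw [nhdsWithin])
  have hlim : Tendsto (fun g : C(𝔻, ℂ) => g) (𝓝[(HolDisc : Set C(𝔻, ℂ))] f) (𝓝 f) :=
    nhdsWithin_le_nhds
  rw [ContinuousMap.tendsto_iff_tendstoLocallyUniformly] at hlim
  let e : C(𝔻, ℂ) → ℂ → ℂ := fun g z => if h : ‖z‖ < 1 then g (Complex.UnitDisc.mk z h) else 0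
  have he : ∀ g z, e g (z : 𝔻) = g z := fun g z => by
    simp [e, z.norm_lt_one]
  refine ⟨e f, ?_, he f⟩
  refine TendstoLocallyUniformlyOn.differentiableOn (F := e)
    (φ := 𝓝[(HolDisc : Set C(𝔻, ℂ))] f) ?_ ?_ Metric.isOpen_ball
  · rw [tendstoLocallyUniformlyOn_iff_tendstoLocallyUniformly_comp_coe]
    intro u hu z
    obtain ⟨t, ht, h⟩ := hlim u hu (Complex.UnitDisc.mk z (mem_ball_zero_iff.1 z.2))
    refine ⟨t, ht, h.mono fun g hg w hw => ?_⟩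
    have := hg (w : 𝔻) hw
    have h1 : ∀ g, e g w = g (w : 𝔻) := fun g => he g (w : 𝔻)
    simp only [Function.comp_apply]
    rw [h1, h1]
    exact this
  · filter_upwards [self_mem_nhdsWithin] with g hg
    obtain ⟨G, hG, hGg⟩ := hg
    refine hG.congr fun z hz => ?_
    obtain ⟨w, rfl⟩ := exists_unitDisc_eq hz
    rw [he, hGg]

instance : BaireSpace HolDisc := by
  have : CompleteSpace HolDisc := isClosed_coe.completeSpace_coe
  have : (uniformity HolDisc).IsCountablyGenerated :=
    Filter.comap.isCountablyGenerated (uniformity C(𝔻, ℂ)) _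
  infer_instance

/-- Uniform estimates on compact sets define the topology of `HolDisc`. -/
theorem exists_compact_of_isOpen {V : Set HolDisc} (hV : IsOpen V) {g : HolDisc} (hg : g ∈ V) :
    ∃ K : Set 𝔻, IsCompact K ∧ ∃ ε > 0, ∀ f : HolDisc,
      (∀ z ∈ K, ‖f.1 z - g.1 z‖ < ε) → f ∈ V := by
  obtain ⟨U, hU, rfl⟩ := isOpen_induced_iff.1 hV
  have h1 := hU.mem_nhds (show g.1 ∈ U from hg)
  rw [((Metric.uniformity_basis_dist (α := ℂ)).compactConvergenceUniformity
    (α := 𝔻) |> nhds_basis_uniformity').mem_iff] at h1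
  obtain ⟨⟨K, ε⟩, ⟨hK, hε⟩, h⟩ := h1
  refine ⟨K, hK, ε, hε, fun f hf => h ?_⟩
  intro z hz
  have := hf z hz
  rw [← dist_eq_norm, dist_comm] at this
  exact this

/-- The holomorphic functions that vanish to second order at a boundary point form a dense set. -/
theorem dense_setOf_isBigO_sq (ω : Circle) :
    Dense {f : HolDisc | ∃ A : ℝ, ∀ z : 𝔻, ‖f.1 z‖ ≤ A * ‖(ω : ℂ) - z‖ ^ 2} := by
  intro f
  obtain ⟨F, hF, hFf⟩ := f.2
  have hω : ‖(ω : ℂ)‖ = 1 := ω.norm_coe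
  have hne : ∀ (s : unitInterval) {z : ℂ}, ‖z‖ < 1 → (ω : ℂ) * (1 + (s : ℝ)) - z ≠ 0 := by
    intro s z hz h
    have h1 : ‖(ω : ℂ) * (1 + (s : ℝ))‖ = 1 + s := by
      rw [norm_mul, hω, one_mul, ← Complex.ofReal_one, ← Complex.ofReal_add,
        Complex.norm_of_nonneg (by linarith [s.2.1])]
    rw [sub_eq_zero.1 h] at h1
    linarith [s.2.1]
  have hmem : ∀ (s : unitInterval) {z : ℂ}, ‖z‖ < 1 →
      (1 - (s : ℝ) : ℂ) * z ∈ Metric.ball (0 : ℂ) 1 := by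
    intro s z hz
    rw [mem_ball_zero_iff, norm_mul, ← Complex.ofReal_one, ← Complex.ofReal_sub,
      Complex.norm_of_nonneg (by linarith [s.2.2])]
    nlinarith [norm_nonneg z, s.2.1, s.2.2]
  -- A path from `f` at `s = 0`. For `s > 0` the dilated function is bounded, and the pole lies
  -- outside the disc at distance at least `s`, leaving a double zero at `ω`.
  let E : unitInterval → ℂ → ℂ := fun s z =>
    F ((1 - (s : ℝ) : ℂ) * z) * (((ω : ℂ) - z) / (ω * (1 + (s : ℝ)) - z)) ^ 2
  have hEcont : Continuous fun x : unitInterval × 𝔻 => E x.1 x.2 := by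
    have hs : Continuous fun x : unitInterval × 𝔻 => ((x.1 : ℝ) : ℂ) :=
      Complex.continuous_ofReal.comp (continuous_subtype_val.comp continuous_fst)
    have hz : Continuous fun x : unitInterval × 𝔻 => (x.2 : ℂ) :=
      Complex.UnitDisc.continuous_coe.comp continuous_snd
    have hFc : Continuous fun x : unitInterval × 𝔻 => F ((1 - ((x.1 : ℝ) : ℂ)) * (x.2 : ℂ)) :=
      hF.continuousOn.comp_continuous ((continuous_const.sub hs).mul hz)
        fun x => hmem x.1 x.2.norm_lt_one
    have hd : Continuous fun x : unitInterval × 𝔻 =>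
        ((ω : ℂ) - x.2) / (ω * (1 + ((x.1 : ℝ) : ℂ)) - x.2) :=
      (continuous_const.sub hz).div ((continuous_const.mul (continuous_const.add hs)).sub hz)
        fun x => hne x.1 x.2.norm_lt_one
    exact hFc.mul (hd.pow 2)
  have hEd : ∀ s, DifferentiableOn ℂ (E s) (Metric.ball 0 1) := by
    intro s
    have h1 : ∀ r : ℂ, Differentiable ℂ fun z : ℂ => r * z := fun r => by fun_prop
    have h2 : ∀ r : ℂ, Differentiable ℂ fun z : ℂ => r - z := fun r => by fun_prop
    have h3 := hF.comp (h1 _).differentiableOn fun z hz => hmem s (mem_ball_zero_iff.1 hz)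
    have h4 := (h2 ω).differentiableOn.div (h2 _).differentiableOn
      fun z hz => hne s (mem_ball_zero_iff.1 hz)
    exact h3.mul (h4.pow 2)
  let c : unitInterval → HolDisc := fun s =>
    ⟨⟨fun z => E s z, hEcont.comp (Continuous.prodMk_right s)⟩, E s, hEd s, fun z => rfl⟩
  have hc : Continuous c :=
    (ContinuousMap.continuous_of_continuous_uncurry (fun s => (c s).1) hEcont).subtype_mk _
  have hc0 : c 0 = f := by
    refine Subtype.ext (ContinuousMap.ext fun z => ?_)
    have h1 : (ω : ℂ) - z ≠ 0 := by simpa using hne 0 z.norm_lt_one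
    have h2 : (c 0).1 z = E 0 z := rfl
    rw [h2]
    simp [E, div_self h1, hFf]
  rw [← hc0]
  have : (𝓝[>] (0 : unitInterval)).NeBot := nhdsGT_neBot_of_exists_gt ⟨1, zero_lt_one⟩
  refine mem_closure_of_tendsto (b := 𝓝[>] (0 : unitInterval)) (f := c)
    (hc.continuousAt.mono_left nhdsWithin_le_nhds) ?_
  filter_upwards [self_mem_nhdsWithin] with s hs
  have hs0 : (0 : ℝ) < s := hs
  have hcomp : IsCompact (Metric.closedBall (0 : ℂ) (1 - s)) := isCompact_closedBall _ _
  obtain ⟨M, hM⟩ := hcomp.exists_bound_of_continuousOn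
    (hF.continuousOn.mono (Metric.closedBall_subset_ball (by linarith)))
  refine ⟨M / s ^ 2, fun z => ?_⟩
  have hz := z.norm_lt_one
  have h1 : (s : ℝ) ≤ ‖(ω : ℂ) * (1 + (s : ℝ)) - z‖ := by
    have h2 : ‖(ω : ℂ) * (1 + (s : ℝ))‖ = 1 + s := by
      rw [norm_mul, hω, one_mul, ← Complex.ofReal_one, ← Complex.ofReal_add,
        Complex.norm_of_nonneg (by linarith [s.2.1])]
    have := norm_sub_norm_le ((ω : ℂ) * (1 + (s : ℝ))) z
    linarith
  have h2 : ‖F ((1 - (s : ℝ) : ℂ) * z)‖ ≤ M := by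
    refine hM _ ?_
    rw [mem_closedBall_zero_iff, norm_mul, ← Complex.ofReal_one, ← Complex.ofReal_sub,
      Complex.norm_of_nonneg (by linarith [s.2.2])]
    nlinarith [s.2.2]
  have hM0 : 0 ≤ M := (norm_nonneg _).trans h2
  change ‖E s z‖ ≤ _
  simp only [E, norm_mul, norm_pow, norm_div, div_pow]
  calc _ ≤ M * (‖(ω : ℂ) - z‖ ^ 2 / (s : ℝ) ^ 2) := by gcongr
    _ = _ := by ring

end HolDisc

/-! ### Transfer to the upper half-plane -/

open scoped UpperHalfPlane

local notation "ℍₒ" => UpperHalfPlane.upperHalfPlaneSet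

theorem Complex.im_pos_iff_norm_sub_I_lt {w : ℂ} :
    0 < w.im ↔ ‖w - Complex.I‖ < ‖w + Complex.I‖ := by
  rw [← sq_lt_sq₀ (norm_nonneg _) (norm_nonneg _), ← Complex.normSq_eq_norm_sq,
    ← Complex.normSq_eq_norm_sq, Complex.normSq_apply, Complex.normSq_apply]
  simp only [Complex.sub_re, Complex.sub_im, Complex.add_re, Complex.add_im, Complex.I_re,
    Complex.I_im]
  constructor <;> intro h <;> nlinarith

theorem Complex.add_I_ne_zero_of_im_pos {w : ℂ} (hw : 0 < w.im) : w + Complex.I ≠ 0 := fun h => by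
  have := congrArg Complex.im h
  simp only [Complex.add_im, Complex.I_im, Complex.zero_im] at this
  linarith

theorem Complex.UnitDisc.circle_sub_ne_zero (ω : Circle) {z : ℂ} (hz : ‖z‖ < 1) :
    (ω : ℂ) - z ≠ 0 := fun h => by
  rw [← sub_eq_zero.1 h, ω.norm_coe] at hz
  exact lt_irrefl _ hz

theorem cayley_sub_I {ω z : ℂ} (h : ω - z ≠ 0) :
    Complex.I * (ω + z) / (ω - z) - Complex.I = 2 * Complex.I * z / (ω - z) := by
  field_simp
  ring

theorem cayley_add_I {ω z : ℂ} (h : ω - z ≠ 0) :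
    Complex.I * (ω + z) / (ω - z) + Complex.I = 2 * Complex.I * ω / (ω - z) := by
  field_simp
  ring

/-- The Cayley transform of the disc onto the upper half-plane that sends `ω` to infinity. -/
noncomputable def cayley (ω : Circle) : 𝔻 ≃ₜ ℍ where
  toFun z := ⟨Complex.I * (ω + z) / (ω - z), by
    have h := Complex.UnitDisc.circle_sub_ne_zero ω z.norm_lt_one
    rw [Complex.im_pos_iff_norm_sub_I_lt, cayley_sub_I h, cayley_add_I h]
    have := z.norm_lt_one
    have h' := norm_pos_iff.2 h
    simp only [norm_div, norm_mul, ω.norm_coe, Complex.norm_I, Complex.norm_ofNat]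
    gcongr⟩
  invFun w := Complex.UnitDisc.mk (ω * (w - Complex.I) / (w + Complex.I)) (by
    have := Complex.im_pos_iff_norm_sub_I_lt.1 w.coe_im_pos
    rw [norm_div, norm_mul, ω.norm_coe, one_mul]
    exact (div_lt_one ((norm_nonneg _).trans_lt this)).2 this)
  left_inv z := by
    have h := Complex.UnitDisc.circle_sub_ne_zero ω z.norm_lt_one
    have hω : (ω : ℂ) ≠ 0 := ω.coe_ne_zero
    rw [← Complex.UnitDisc.coe_inj, Complex.UnitDisc.coe_mk]
    simp only [cayley_sub_I h, cayley_add_I h]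
    field_simp
  right_inv w := by
    have h := Complex.add_I_ne_zero_of_im_pos w.coe_im_pos
    have hω : (ω : ℂ) ≠ 0 := ω.coe_ne_zero
    apply UpperHalfPlane.ext
    simp only [Complex.UnitDisc.coe_mk]
    have h1 : (ω : ℂ) - ω * (w - Complex.I) / (w + Complex.I) =
        2 * Complex.I * ω / (w + Complex.I) := by
      field_simp
      ring
    rw [h1]
    field_simp
    ring
  continuous_toFun := by
    refine Continuous.upperHalfPlaneMk (Continuous.div ?_ ?_ fun z =>
      Complex.UnitDisc.circle_sub_ne_zero ω z.norm_lt_one) _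
    · exact continuous_const.mul (continuous_const.add Complex.UnitDisc.continuous_coe)
    · exact continuous_const.sub Complex.UnitDisc.continuous_coe
  continuous_invFun := by
    rw [Complex.UnitDisc.isEmbedding_coe.continuous_iff]
    refine Continuous.div (f := fun w : ℍ => (ω : ℂ) * (w - Complex.I))
      (g := fun w : ℍ => (w : ℂ) + Complex.I) ?_ ?_ fun w =>
      Complex.add_I_ne_zero_of_im_pos w.coe_im_pos
    · exact continuous_const.mul (UpperHalfPlane.continuous_coe.sub continuous_const)
    · exact UpperHalfPlane.continuous_coe.add continuous_const

theorem coe_cayley (ω : Circle) (z : 𝔻) :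
    (cayley ω z : ℂ) = Complex.I * (ω + z) / (ω - z) := rfl

theorem coe_cayley_symm (ω : Circle) (w : ℍ) :
    ((cayley ω).symm w : ℂ) = ω * (w - Complex.I) / (w + Complex.I) := rfl

/-- This reciprocity converts a double zero at `ω` into quadratic decay at infinity, and convergence
to `ω` into unboundedness. -/
theorem norm_cayley_add_I (ω : Circle) (z : 𝔻) :
    ‖(cayley ω z : ℂ) + Complex.I‖ * ‖(ω : ℂ) - z‖ = 2 := by
  have h := Complex.UnitDisc.circle_sub_ne_zero ω z.norm_lt_one
  have h' := norm_ne_zero_iff.2 h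
  rw [coe_cayley, cayley_add_I h]
  simp only [norm_div, norm_mul, ω.norm_coe, Complex.norm_I, Complex.norm_ofNat]
  field_simp

/-- The holomorphic function on the disc that corresponds to a holomorphic function on the upper
half-plane. -/
noncomputable def HolDisc.ofUpper (ω : Circle) (F : ℂ → ℂ)
    (hF : DifferentiableOn ℂ F ℍₒ) : HolDisc :=
  ⟨⟨fun z => F (cayley ω z), hF.continuousOn.comp_continuous
      (UpperHalfPlane.continuous_coe.comp (cayley ω).continuous) fun z => (cayley ω z).coe_im_pos⟩,
    fun z => F (Complex.I * (ω + z) / (ω - z)), by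
      have h1 : Differentiable ℂ fun z : ℂ => Complex.I * (ω + z) := by fun_prop
      have h2 : Differentiable ℂ fun z : ℂ => (ω : ℂ) - z := by fun_prop
      refine hF.comp (h1.differentiableOn.div h2.differentiableOn fun z hz =>
        Complex.UnitDisc.circle_sub_ne_zero ω (mem_ball_zero_iff.1 hz)) fun z hz => ?_
      obtain ⟨w, rfl⟩ := HolDisc.exists_unitDisc_eq hz
      exact (cayley ω w).coe_im_pos, fun z => rfl⟩

theorem HolDisc.ofUpper_apply (ω : Circle) (F : ℂ → ℂ) (hF : DifferentiableOn ℂ F ℍₒ)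
    (z : 𝔻) : (HolDisc.ofUpper ω F hF).1 z = F (cayley ω z) := rfl

theorem HolDisc.exists_eq_ofUpper (ω : Circle) (f : HolDisc) :
    ∃ F, ∃ hF : DifferentiableOn ℂ F ℍₒ, f = HolDisc.ofUpper ω F hF := by
  obtain ⟨G, hG, hGf⟩ := f.2
  have h1 : Differentiable ℂ fun w : ℂ => (ω : ℂ) * (w - Complex.I) := by fun_prop
  have h2 : Differentiable ℂ fun w : ℂ => w + Complex.I := by fun_prop
  refine ⟨fun w => G (ω * (w - Complex.I) / (w + Complex.I)), ?_, ?_⟩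
  · refine hG.comp (h1.differentiableOn.div h2.differentiableOn fun w hw =>
      Complex.add_I_ne_zero_of_im_pos hw) fun w hw => ?_
    rw [mem_ball_zero_iff]
    exact ((cayley ω).symm ⟨w, hw⟩).norm_lt_one
  · refine Subtype.ext (ContinuousMap.ext fun z => ?_)
    rw [HolDisc.ofUpper_apply, ← coe_cayley_symm, Homeomorph.symm_apply_apply, hGf]

/-- A function on the upper half-plane with quadratic decay at infinity. -/
noncomputable def QuadraticDecay (F : ℂ → ℂ) : Prop :=
  ∃ A : ℝ, ∀ w : ℂ, 0 < w.im → ‖F w‖ ≤ A / ‖w + Complex.I‖ ^ 2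

theorem HolDisc.exists_quadraticDecay_mem (ω : Circle) {V : Set HolDisc} (hV : IsOpen V)
    (hne : V.Nonempty) :
    ∃ F, ∃ hF : DifferentiableOn ℂ F ℍₒ, QuadraticDecay F ∧ HolDisc.ofUpper ω F hF ∈ V := by
  obtain ⟨f, hfV, A, hA⟩ := (HolDisc.dense_setOf_isBigO_sq ω).inter_open_nonempty V hV hne
  obtain ⟨F, hF, rfl⟩ := HolDisc.exists_eq_ofUpper ω f
  refine ⟨F, hF, ⟨A * 4, fun w hw => ?_⟩, hfV⟩
  have h1 := hA ((cayley ω).symm ⟨w, hw⟩)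
  have h2 := norm_cayley_add_I ω ((cayley ω).symm ⟨w, hw⟩)
  rw [HolDisc.ofUpper_apply, Homeomorph.apply_symm_apply] at h1
  rw [Homeomorph.apply_symm_apply] at h2
  have h3 : 0 < ‖w + Complex.I‖ := norm_pos_iff.2 (Complex.add_I_ne_zero_of_im_pos hw)
  change ‖F w‖ ≤ _ at h1
  change ‖w + Complex.I‖ * _ = 2 at h2
  rw [le_div_iff₀ (by positivity)]
  refine (mul_le_mul_of_nonneg_right h1 (by positivity)).trans_eq ?_
  rw [mul_assoc, ← mul_pow, mul_comm ‖(ω : ℂ) - _‖, h2]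
  norm_num

theorem HolDisc.comp_cayley_mem (ω : Circle) (f : HolDisc) (ψ : C(𝔻, 𝔻)) {φ : ℂ → ℂ}
    (hφ : DifferentiableOn ℂ φ ℍₒ) (h : ∀ z, (cayley ω (ψ z) : ℂ) = φ (cayley ω z)) :
    f.1.comp ψ ∈ HolDisc := by
  obtain ⟨F, hF, rfl⟩ := HolDisc.exists_eq_ofUpper ω f
  have hmaps : Set.MapsTo φ ℍₒ ℍₒ := fun w hw => by
    have := h ((cayley ω).symm ⟨w, hw⟩)
    rw [Homeomorph.apply_symm_apply] at this
    change _ = φ w at this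
    rw [← this]
    exact (cayley ω _).coe_im_pos
  have : (HolDisc.ofUpper ω F hF).1.comp ψ = (HolDisc.ofUpper ω (F ∘ φ) (hF.comp hφ hmaps)).1 := by
    ext z
    simp only [ContinuousMap.comp_apply, HolDisc.ofUpper_apply, Function.comp_apply, h]
  rw [this]
  exact Subtype.prop _

/-! ### Common hypercyclicity for flows -/

/-- Common hypercyclicity along the flows `Φ · q` on the upper half-plane, under separation
hypotheses that allow one to correct a given function `h` by a finite sum of the functions
`S r`, where `S r` is close to `g ∘ Φ (-r) q`. -/
theorem setOf_forall_dense_flow_orbit_mem_residual {Q : Type*} [TopologicalSpace Q]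
    [SecondCountableTopology Q] [LocallyCompactSpace Q] (ω : Circle) (Φ : ℝ → Q → ℍ → ℍ)
    (hΦ : Continuous fun x : (ℝ × Q) × ℍ => Φ x.1.1 x.1.2 x.2)
    (hol : ∀ s q, ∃ φ : ℂ → ℂ, DifferentiableOn ℂ φ ℍₒ ∧ ∀ w : ℍ, (Φ s q w : ℂ) = φ w)
    (hzero : ∀ q w, Φ 0 q w = w)
    (hgrow : ∀ K : Set ℍ, IsCompact K → ∃ b > 0, ∀ s > 0, ∀ q, ∀ w ∈ K,
      b * s ≤ ‖(Φ s q w : ℂ) + Complex.I‖)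
    (hS : ∀ g : ℂ → ℂ, DifferentiableOn ℂ g ℍₒ → QuadraticDecay g → ∀ q₀, ∀ K : Set ℍ,
      IsCompact K → ∀ ε > 0, ∃ δ > 0, ∃ Λ ∈ 𝓝 q₀, ∃ S : ℝ → ℂ → ℂ,
        (∀ r, DifferentiableOn ℂ (S r) ℍₒ) ∧
        (∀ s r, 0 ≤ s → 0 ≤ r → |s - r| ≤ δ → ∀ q ∈ Λ, ∀ w ∈ K, ‖S r (Φ s q w) - g w‖ ≤ ε) ∧
        ∀ K' : Set ℍ, IsCompact K' → ∃ B : ℝ, ∀ s r, 0 ≤ s → 0 ≤ r → s ≠ r → ∀ q ∈ Λ, ∀ w ∈ K',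
          ‖S r (Φ s q w)‖ ≤ B / (s - r) ^ 2) :
    {f : HolDisc | ∀ t > 0, ∀ q, Dense {y : HolDisc | ∃ n : ℕ, 1 ≤ n ∧
      ∀ z, y.1 z = f.1 ((cayley ω).symm (Φ (n * t) q (cayley ω z)))}} ∈ residual HolDisc := by
  have : LocallyCompactSpace (Set.Ioi (0 : ℝ)) := isOpen_Ioi.locallyCompactSpace
  have hψ : Continuous fun x : (ℝ × Q) × 𝔻 => (cayley ω).symm (Φ x.1.1 x.1.2 (cayley ω x.2)) :=
    (cayley ω).symm.continuous.comp
      (hΦ.comp (continuous_fst.prodMk ((cayley ω).continuous.comp continuous_snd)))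
  let ψ : ℝ × Q → C(𝔻, 𝔻) := fun x =>
    ⟨fun z => (cayley ω).symm (Φ x.1 x.2 (cayley ω z)), hψ.comp (Continuous.prodMk_right x)⟩
  have hψc : Continuous ψ := ContinuousMap.continuous_of_continuous_uncurry ψ hψ
  let T : ℕ → Set.Ioi (0 : ℝ) × Q → HolDisc → HolDisc := fun n p f =>
    ⟨f.1.comp (ψ (n * p.1, p.2)), by
      obtain ⟨φ, hφ, h⟩ := hol (n * p.1) p.2
      refine HolDisc.comp_cayley_mem ω f _ hφ fun z => ?_
      rw [← h]
      exact congrArg _ ((cayley ω).apply_symm_apply _)⟩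
  have hT : ∀ n, Continuous fun a : (Set.Ioi (0 : ℝ) × Q) × HolDisc => T n a.1 a.2 := by
    intro n
    refine Continuous.subtype_mk ((continuous_subtype_val.comp continuous_snd).compCM
      (hψc.comp (Continuous.prodMk ?_ ?_))) _
    · exact continuous_const.mul
        (continuous_subtype_val.comp (continuous_fst.comp continuous_fst))
    · exact continuous_snd.comp continuous_fst
  have hTu : ∀ n p F hF z, (T n p (HolDisc.ofUpper ω F hF)).1 z =
      F (Φ (n * p.1) p.2 (cayley ω z)) := by
    intro n p F hF z
    change F (cayley ω ((cayley ω).symm _)) = _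
    rw [Homeomorph.apply_symm_apply]
  have main := setOf_forall_dense_mem_residual T hT ?_
  · filter_upwards [main] with f hf t ht q
    refine (hf (⟨t, ht⟩, q)).mono ?_
    rintro y ⟨n, hn, rfl⟩
    exact ⟨n, hn, fun z => rfl⟩
  rintro V hV hVne ⟨⟨t₀, ht₀⟩, q₀⟩
  obtain ⟨g, hg, hgd, hgV⟩ := HolDisc.exists_quadraticDecay_mem ω hV hVne
  obtain ⟨K, hK, ε, hε, hKV⟩ := HolDisc.exists_compact_of_isOpen hV hgV
  have hK₁ := hK.image (cayley ω).continuous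
  obtain ⟨δ, hδ, Λ, hΛ, S, hSd, hSg, hSB⟩ := hS g hg hgd q₀ _ hK₁ (ε / 4) (by positivity)
  have ht₀' : (0 : ℝ) < t₀ := ht₀
  refine ⟨(Subtype.val ⁻¹' Set.Icc (t₀ / 2) (2 * t₀)) ×ˢ Λ, prod_mem_nhds
    (continuous_subtype_val.continuousAt.preimage_mem_nhds
      (Icc_mem_nhds (by simp only; linarith) (by simp only; linarith))) hΛ, ?_⟩
  -- `δ`, `Λ` and `S` depend only on `V`; the constants below may depend on `W` as well, and `η`
  -- absorbs them.
  intro W hW hWne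
  obtain ⟨h, hh, ⟨A, hA⟩, hhW⟩ := HolDisc.exists_quadraticDecay_mem ω hW hWne
  obtain ⟨L, hL, ε', hε', hLW⟩ := HolDisc.exists_compact_of_isOpen hW hhW
  have hL₁ := hL.image (cayley ω).continuous
  -- On `L` the bound is used at time `0`, to keep `f` near `h`; on `K` at time `n * t`, for the
  -- terms that miss the target.
  obtain ⟨B, hB⟩ := hSB _ (hK₁.union hL₁)
  obtain ⟨b, hb, hbg⟩ := hgrow _ hK₁
  obtain ⟨M, hM⟩ : ∃ M, M = |B| + |A| / b ^ 2 + 1 := ⟨_, rfl⟩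
  have hM0 : 0 < M := by rw [hM]; positivity
  obtain ⟨η, hη⟩ : ∃ η, η = min ε ε' / (4 * M) := ⟨_, rfl⟩
  have hη0 : 0 < η := by rw [hη]; positivity
  have hMη : M * η = min ε ε' / 4 := by rw [hη]; field_simp
  have hBη : |B| * η ≤ min ε ε' / 4 := by
    rw [← hMη, hM]
    exact mul_le_mul_of_nonneg_right (by linarith [show 0 ≤ |A| / b ^ 2 by positivity]) hη0.le
  have hAη : |A| / b ^ 2 * η ≤ min ε ε' / 4 := by
    rw [← hMη, hM]
    exact mul_le_mul_of_nonneg_right (by linarith [abs_nonneg B]) hη0.le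
  have hε4 : min ε ε' / 4 ≤ ε / 4 := by linarith [min_le_left ε ε']
  have hε4' : min ε ε' / 4 ≤ ε' / 4 := by linarith [min_le_right ε ε']
  obtain ⟨m, s, hs, hsum, hcov⟩ :=
    exists_separated_approximations (t₁ := t₀ / 2) (t₂ := 2 * t₀) (by linarith) hδ hη0
  have hest : ∀ (J : Finset ℕ) (x : ℝ), 0 ≤ x → (∀ j ∈ J, x ≠ s j) → ∀ q ∈ Λ,
      ∀ w ∈ cayley ω '' K ∪ cayley ω '' L, ∑ j ∈ J, 1 / (x - s j) ^ 2 ≤ η →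
      ‖∑ j ∈ J, S (s j) (Φ x q w)‖ ≤ min ε ε' / 4 := by
    intro J x hx hxs q hq w hw hJ
    refine le_trans ?_ hBη
    refine le_trans ?_ (mul_le_mul_of_nonneg_left hJ (abs_nonneg B))
    rw [Finset.mul_sum]
    refine norm_sum_le_of_le _ fun j hj => (hB x (s j) hx (hs j).le (hxs j hj) q hq w hw).trans ?_
    rw [mul_one_div]
    gcongr
    exact le_abs_self B
  have hF : DifferentiableOn ℂ (fun w => h w + ∑ i ∈ Finset.range m, S (s i) w) ℍₒ :=
    hh.add (DifferentiableOn.fun_sum fun i _ => hSd (s i))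
  refine ⟨HolDisc.ofUpper ω _ hF, hLW _ fun z hz => ?_, ?_⟩
  · rw [HolDisc.ofUpper_apply, HolDisc.ofUpper_apply, add_sub_cancel_left]
    have := hest (Finset.range m) 0 le_rfl (fun j _ => (hs j).ne) q₀ (mem_of_mem_nhds hΛ)
      (cayley ω z) (Or.inr ⟨z, hz, rfl⟩) (by simpa using hsum)
    rw [hzero] at this
    linarith
  · rintro ⟨t, q⟩ ⟨ht, hq⟩
    obtain ⟨n, hn, hnη, i, hi, hδi, hne, hsum'⟩ := hcov t ht
    refine ⟨n, hn, hKV _ fun z hz => ?_⟩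
    have hnt : (0 : ℝ) < n * t := mul_pos (by exact_mod_cast hn) t.2
    rw [hTu, HolDisc.ofUpper_apply, ← Finset.add_sum_erase _ _ hi]
    have hzK : cayley ω z ∈ cayley ω '' K := ⟨z, hz, rfl⟩
    have e1 := hest _ _ hnt.le hne q hq _ (Or.inl hzK) hsum'
    have e2 := hSg _ _ hnt.le (hs i).le hδi q hq _ hzK
    have e3 : ‖h (Φ (n * t) q (cayley ω z))‖ ≤ min ε ε' / 4 := by
      refine le_trans (hA _ (Φ (n * t) q (cayley ω z)).coe_im_pos) (le_trans ?_ hAη)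
      have h1 := hbg _ hnt q _ hzK
      have h2 : 0 < b * (n * t) := by positivity
      calc _ ≤ |A| / (b * (n * t)) ^ 2 := by
            gcongr
            exact le_abs_self A
        _ = |A| / b ^ 2 * (1 / (n * t) ^ 2) := by
            rw [mul_pow]
            field_simp
        _ ≤ _ := by gcongr
    -- Three errors of at most `ε / 4` each: `h` far out along the flow, the term aimed at `g`, and
    -- the other terms.
    have hsplit : ∀ a x y c : ℂ, a + (x + y) - c = a + (x - c) + y := fun _ _ _ _ => by ring
    rw [hsplit]
    refine (norm_add₃_le ..).trans_lt ?_
    linarith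

/-! ### Estimates and the parabolic flow -/

theorem UpperHalfPlane.exists_bounds_of_isCompact {K : Set ℍ} (hK : IsCompact K) :
    ∃ m > 0, ∃ R > 0, ∀ w ∈ K, m ≤ (w : ℂ).im ∧ ‖(w : ℂ)‖ ≤ R := by
  obtain ⟨R, hR⟩ := hK.exists_bound_of_continuousOn UpperHalfPlane.continuous_coe.continuousOn
  rcases K.eq_empty_or_nonempty with rfl | hne
  · exact ⟨1, one_pos, 1, one_pos, by simp⟩
  · obtain ⟨w₀, -, hw₀⟩ := hK.exists_isMinOn hne UpperHalfPlane.continuous_im.continuousOn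
    exact ⟨w₀.im, w₀.im_pos, max R 1, by positivity,
      fun w hw => ⟨hw₀ hw, (hR w hw).trans (le_max_left _ _)⟩⟩

theorem DifferentiableOn.exists_forall_norm_sub_le {g : ℂ → ℂ} (hg : DifferentiableOn ℂ g ℍₒ)
    {K : Set ℍ} (hK : IsCompact K) {ε : ℝ} (hε : 0 < ε) :
    ∃ ρ > 0, ∀ w ∈ K, ∀ v : ℂ, ‖v - w‖ < ρ → ‖g v - g w‖ ≤ ε := by
  have h := (hK.image UpperHalfPlane.continuous_coe).uniformContinuousAt_of_continuousAt g
    (fun w hw => by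
      obtain ⟨w, -, rfl⟩ := hw
      exact (hg.continuousOn.continuousAt
        (UpperHalfPlane.isOpen_upperHalfPlaneSet.mem_nhds w.coe_im_pos)))
    (Metric.dist_mem_uniformity hε)
  obtain ⟨ρ, hρ, h⟩ := Metric.mem_uniformity_dist.1 h
  refine ⟨ρ, hρ, fun w hw v hv => ?_⟩
  have := h (a := (w : ℂ)) (b := v) (by rwa [dist_comm, dist_eq_norm]) ⟨w, hw, rfl⟩
  change Dist.dist _ _ < ε at this
  rw [dist_comm, dist_eq_norm] at this
  exact this.le

theorem Complex.im_add_one_le_norm_add_I (w : ℂ) : w.im + 1 ≤ ‖w + Complex.I‖ := by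
  have := (le_abs_self _).trans (Complex.abs_im_le_norm (w + Complex.I))
  simpa using this

theorem QuadraticDecay.exists_nonneg {g : ℂ → ℂ} (hg : QuadraticDecay g) :
    ∃ A ≥ 0, ∀ w : ℂ, 0 < w.im → ‖g w‖ ≤ A / ‖w + Complex.I‖ ^ 2 := by
  obtain ⟨A, hA⟩ := hg
  refine ⟨|A|, abs_nonneg A, fun w hw => (hA w hw).trans ?_⟩
  gcongr
  exact le_abs_self A

/-- Weakens the exponential estimates of the hyperbolic case to the inverse-square form shared with
the parabolic one. -/
theorem Real.exp_neg_le_two_div_sq {x : ℝ} (hx : 0 < x) : Real.exp (-x) ≤ 2 / x ^ 2 := by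
  have := Real.quadratic_le_exp_of_nonneg hx.le
  rw [Real.exp_neg, inv_eq_one_div, div_le_div_iff₀ (Real.exp_pos x) (by positivity)]
  linarith

/-- The triangle inequality loses the constant `R + 1`, which is absorbed because the norm on the
right is at least `1`. -/
theorem norm_add_I_le_mul_norm_translate {w : ℂ} (hw : 0 < w.im) {x R : ℝ} (hR : ‖w‖ ≤ R) :
    |x| ≤ (R + 2) * ‖w + x + Complex.I‖ := by
  have h1 : 1 ≤ ‖w + x + Complex.I‖ := by
    have := Complex.im_add_one_le_norm_add_I (w + x)
    simp only [Complex.add_im, Complex.ofReal_im, add_zero] at this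
    linarith
  have h2 : |x| ≤ ‖w + x + Complex.I‖ + ‖w + Complex.I‖ := by
    rw [← Real.norm_eq_abs, ← Complex.norm_real]
    refine le_trans (le_of_eq ?_) (norm_sub_le _ _)
    congr 1
    ring
  have h3 : ‖w + Complex.I‖ ≤ R + 1 :=
    (norm_add_le _ _).trans (by rw [Complex.norm_I]; linarith)
  nlinarith [norm_nonneg w]

/-- The flow of translations of the upper half-plane with velocity `σ`. -/
noncomputable def parabolicFlow (σ s : ℝ) (_ : Unit) (w : ℍ) : ℍ := (σ * s) +ᵥ w

theorem coe_parabolicFlow (σ s : ℝ) (u : Unit) (w : ℍ) :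
    (parabolicFlow σ s u w : ℂ) = w + ((σ * s : ℝ) : ℂ) := by
  rw [parabolicFlow, UpperHalfPlane.coe_vadd, add_comm]

theorem parabolicFlow_dense_mem_residual (ω : Circle) {σ : ℝ} (hσ : |σ| = 1) :
    {f : HolDisc | ∀ t > 0, ∀ q, Dense {y : HolDisc | ∃ n : ℕ, 1 ≤ n ∧
      ∀ z, y.1 z = f.1 ((cayley ω).symm (parabolicFlow σ (n * t) q (cayley ω z)))}} ∈
      residual HolDisc := by
  have hR : ∀ K : Set ℍ, IsCompact K → ∃ C > 0, ∀ w ∈ K, ∀ x : ℝ,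
      |x| ≤ C * ‖(w : ℂ) + x + Complex.I‖ := by
    intro K hK
    obtain ⟨_, _, R, hR, h⟩ := UpperHalfPlane.exists_bounds_of_isCompact hK
    exact ⟨R + 2, by positivity, fun w hw x =>
      norm_add_I_le_mul_norm_translate w.coe_im_pos (h w hw).2⟩
  have habs : ∀ s : ℝ, |σ * s| = |s| := fun s => by rw [abs_mul, hσ, one_mul]
  apply setOf_forall_dense_flow_orbit_mem_residual
  · rw [UpperHalfPlane.isEmbedding_coe.continuous_iff]
    have : (UpperHalfPlane.coe ∘ fun x : (ℝ × Unit) × ℍ => parabolicFlow σ x.1.1 x.1.2 x.2) =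
        fun x => (x.2 : ℂ) + ((σ * x.1.1 : ℝ) : ℂ) := funext fun x => coe_parabolicFlow ..
    rw [this]
    exact (UpperHalfPlane.continuous_coe.comp continuous_snd).add
      (Complex.continuous_ofReal.comp
        (continuous_const.mul (continuous_fst.comp continuous_fst)))
  · intro s q
    exact ⟨fun w => w + ((σ * s : ℝ) : ℂ), by fun_prop, coe_parabolicFlow σ s q⟩
  · intro q w
    rw [parabolicFlow, mul_zero, zero_vadd]
  · intro K hK
    obtain ⟨C, hC, h⟩ := hR K hK
    refine ⟨C⁻¹, by positivity, fun s hs q w hw => ?_⟩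
    rw [coe_parabolicFlow, inv_mul_le_iff₀ hC]
    refine le_trans ?_ (h w hw _)
    rw [habs, abs_of_pos hs]
  · intro g hg hgd _ K hK ε hε
    obtain ⟨ρ, hρ, hgρ⟩ := hg.exists_forall_norm_sub_le hK hε
    obtain ⟨A, hA, hgA⟩ := hgd.exists_nonneg
    have hcomp : ∀ s r q (w : ℍ), (parabolicFlow σ s q w : ℂ) - ((σ * r : ℝ) : ℂ) =
        w + ((σ * (s - r) : ℝ) : ℂ) := by
      intro s r q w
      rw [coe_parabolicFlow]
      push_cast
      ring
    refine ⟨ρ / 2, by positivity, Set.univ, univ_mem, fun r w => g (w - ((σ * r : ℝ) : ℂ)),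
      fun r => hg.comp (by fun_prop) fun w hw => ?_, ?_, ?_⟩
    · change 0 < (w - ((σ * r : ℝ) : ℂ)).im
      rw [Complex.sub_im, Complex.ofReal_im, sub_zero]
      exact hw
    · intro s r _ _ hsr q _ w hw
      dsimp only
      rw [hcomp]
      refine hgρ w hw _ ?_
      rw [add_sub_cancel_left, Complex.norm_real, Real.norm_eq_abs, habs]
      linarith
    · intro K' hK'
      obtain ⟨C, hC, h⟩ := hR K' hK'
      refine ⟨A * C ^ 2, fun s r _ _ hsr q _ w hw => ?_⟩
      dsimp only
      rw [hcomp]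
      have him : 0 < ((w : ℂ) + ((σ * (s - r) : ℝ) : ℂ)).im := by
        rw [Complex.add_im, Complex.ofReal_im, add_zero]
        exact w.coe_im_pos
      refine (hgA _ him).trans ?_
      have h1 := h w hw (σ * (s - r))
      rw [habs] at h1
      have h2 := norm_pos_iff.2 (Complex.add_I_ne_zero_of_im_pos him)
      have h3 : 0 < |s - r| := abs_pos.2 (sub_ne_zero.2 hsr)
      rw [div_le_div_iff₀ (by positivity) (by rw [← sq_abs]; positivity), ← sq_abs (s - r),
        mul_assoc, ← mul_pow]
      gcongr

/-! ### The hyperbolic flow -/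

/-- The flow of dilations of the upper half-plane from the boundary point `-c`. -/
noncomputable def hyperbolicFlow (s c : ℝ) (w : ℍ) : ℍ :=
  ⟨(Real.exp s : ℝ) * (w + c) - c, by
    simpa [← Complex.ofReal_exp] using mul_pos (Real.exp_pos s) w.im_pos⟩

theorem coe_hyperbolicFlow (s c : ℝ) (w : ℍ) :
    (hyperbolicFlow s c w : ℂ) = (Real.exp s : ℝ) * (w + c) - c := rfl

theorem im_exp_mul_sub (s c : ℝ) (w : ℂ) :
    ((Real.exp s : ℝ) * (w + c) - c : ℂ).im = Real.exp s * w.im := by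
  rw [Complex.sub_im, Complex.im_ofReal_mul, Complex.add_im, Complex.ofReal_im, add_zero, sub_zero]

/-- Undoing the flow from `-c` by the one from `-c₀` costs a shift that for `s ≥ 0` is at most `|c -
c₀|`, however large `s` is. So one `S r`, built with `c₀`, serves all nearby `c`, and only the times
need discretising. -/
theorem exp_neg_mul_hyperbolicFlow (s r c c₀ : ℝ) (w : ℍ) :
    (Real.exp (-r) : ℝ) * ((hyperbolicFlow s c w : ℂ) + c₀) =
      (Real.exp (s - r) : ℝ) * (w + c₀ + ((c - c₀) * (1 - Real.exp (-s)) : ℝ)) := by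
  have h1 : Real.exp s * Real.exp (-s) = 1 := by rw [← Real.exp_add, add_neg_cancel, Real.exp_zero]
  rw [coe_hyperbolicFlow, sub_eq_add_neg s r, Real.exp_add]
  have h2 : ((Real.exp s : ℝ) : ℂ) * ((Real.exp (-s) : ℝ) : ℂ) = 1 := by exact_mod_cast h1
  push_cast only [Complex.ofReal_mul, Complex.ofReal_sub, Complex.ofReal_one]
  linear_combination ((Real.exp (-r) : ℝ) : ℂ) * (c - c₀) * h2

/-- The product of `g` with a factor that is close to `1` for small `κ`, and vanishes at the
boundary point `-c`. -/
noncomputable def vanishingAt (g : ℂ → ℂ) (c κ : ℝ) (u : ℂ) : ℂ :=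
  g u * ((u + c) / (u + c + κ * Complex.I))

section vanishingAt

variable {g : ℂ → ℂ} {c κ : ℝ} {u : ℂ}

theorem le_norm_add_mul_I (hκ : 0 < κ) (hu : 0 < u.im) :
    κ ≤ ‖u + c + κ * Complex.I‖ ∧ u.im ≤ ‖u + c + κ * Complex.I‖ ∧
      ‖u + c‖ ≤ ‖u + c + κ * Complex.I‖ := by
  have him : (u + c + κ * Complex.I).im = u.im + κ := by simp
  have h1 := (le_abs_self _).trans (Complex.abs_im_le_norm (u + c + κ * Complex.I))
  rw [him] at h1
  refine ⟨by linarith, by linarith, ?_⟩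
  rw [← sq_le_sq₀ (norm_nonneg _) (norm_nonneg _), ← Complex.normSq_eq_norm_sq,
    ← Complex.normSq_eq_norm_sq, Complex.normSq_apply, Complex.normSq_apply]
  simp
  nlinarith

theorem add_mul_I_ne_zero (hκ : 0 < κ) (hu : 0 < u.im) : u + c + κ * Complex.I ≠ 0 :=
  norm_pos_iff.1 (hκ.trans_le (le_norm_add_mul_I hκ hu).1)

theorem differentiableOn_vanishingAt (hg : DifferentiableOn ℂ g ℍₒ) (hκ : 0 < κ) :
    DifferentiableOn ℂ (vanishingAt g c κ) ℍₒ := by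
  have h1 : DifferentiableOn ℂ (fun u : ℂ => u + c) ℍₒ := by fun_prop
  have h2 : DifferentiableOn ℂ (fun u : ℂ => u + c + κ * Complex.I) ℍₒ := by fun_prop
  exact hg.mul (h1.div h2 fun u hu => add_mul_I_ne_zero hκ hu)

theorem norm_vanishingAt_le (hκ : 0 < κ) (hu : 0 < u.im) : ‖vanishingAt g c κ u‖ ≤ ‖g u‖ := by
  obtain ⟨h1, -, h3⟩ := le_norm_add_mul_I (c := c) hκ hu
  rw [vanishingAt, norm_mul, norm_div]
  exact mul_le_of_le_one_right (norm_nonneg _) ((div_le_one (hκ.trans_le h1)).2 h3)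

theorem norm_vanishingAt_le_mul_div (hκ : 0 < κ) (hu : 0 < u.im) :
    ‖vanishingAt g c κ u‖ ≤ ‖g u‖ * (‖u + c‖ / κ) := by
  have h1 := (le_norm_add_mul_I (c := c) hκ hu).1
  rw [vanishingAt, norm_mul, norm_div]
  gcongr

theorem norm_vanishingAt_sub_le (hκ : 0 < κ) (hu : 0 < u.im) :
    ‖vanishingAt g c κ u - g u‖ ≤ ‖g u‖ * (κ / u.im) := by
  have h2 := (le_norm_add_mul_I (c := c) hκ hu).2.1
  have h0 := add_mul_I_ne_zero (c := c) hκ hu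
  have : vanishingAt g c κ u - g u = -(g u * (κ * Complex.I / (u + c + κ * Complex.I))) := by
    rw [vanishingAt]
    field_simp
    ring
  rw [this, norm_neg, norm_mul, norm_div, norm_mul, Complex.norm_I, mul_one, Complex.norm_real,
    Real.norm_of_nonneg hκ.le]
  gcongr

end vanishingAt

theorem hyperbolicFlow_dense_mem_residual (ω : Circle) :
    {f : HolDisc | ∀ t > 0, ∀ q, Dense {y : HolDisc | ∃ n : ℕ, 1 ≤ n ∧
      ∀ z, y.1 z = f.1 ((cayley ω).symm (hyperbolicFlow (n * t) q (cayley ω z)))}} ∈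
      residual HolDisc := by
  apply setOf_forall_dense_flow_orbit_mem_residual
  · rw [UpperHalfPlane.isEmbedding_coe.continuous_iff]
    have h1 : Continuous fun x : (ℝ × ℝ) × ℍ => ((Real.exp x.1.1 : ℝ) : ℂ) :=
      Complex.continuous_ofReal.comp
        (Real.continuous_exp.comp (continuous_fst.comp continuous_fst))
    have h2 : Continuous fun x : (ℝ × ℝ) × ℍ => (x.1.2 : ℂ) :=
      Complex.continuous_ofReal.comp (continuous_snd.comp continuous_fst)
    exact (h1.mul ((UpperHalfPlane.continuous_coe.comp continuous_snd).add h2)).sub h2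
  · intro s c
    exact ⟨fun w => (Real.exp s : ℝ) * (w + c) - c, by fun_prop, coe_hyperbolicFlow s c⟩
  · intro c w
    apply UpperHalfPlane.ext
    rw [coe_hyperbolicFlow, Real.exp_zero]
    push_cast
    ring
  · intro K hK
    obtain ⟨m, hm, _, _, h⟩ := UpperHalfPlane.exists_bounds_of_isCompact hK
    refine ⟨m, hm, fun s hs c w hw => ?_⟩
    have h1 := Complex.im_add_one_le_norm_add_I (hyperbolicFlow s c w : ℂ)
    rw [coe_hyperbolicFlow, im_exp_mul_sub] at h1
    have h2 := Real.add_one_le_exp s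
    have h3 := mul_le_mul (h w hw).1 (by linarith : s ≤ Real.exp s) hs.le w.im_pos.le
    rw [coe_hyperbolicFlow]
    linarith [mul_comm (Real.exp s) (w : ℂ).im]
  · intro g hg hgd c₀ K hK ε hε
    obtain ⟨ρ, hρ, hgρ⟩ := hg.exists_forall_norm_sub_le hK (half_pos hε)
    obtain ⟨A, hA, hgA⟩ := hgd.exists_nonneg
    have hgA' : ∀ u : ℂ, 0 < u.im → ‖g u‖ ≤ A ∧ ‖g u‖ ≤ A / u.im := by
      intro u hu
      have h1 := Complex.im_add_one_le_norm_add_I u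
      refine ⟨(hgA u hu).trans (div_le_self hA ?_), (hgA u hu).trans ?_⟩
      · nlinarith
      · gcongr
        nlinarith
    obtain ⟨m, hm, R, hR, hKb⟩ := UpperHalfPlane.exists_bounds_of_isCompact hK
    -- `ξ` bounds `|exp (s - r) - 1|`. The dilation then moves points by at most `ρ / 2`, the change
    -- of centre by at most `3 / 2 * (ρ / 4)`, and the imaginary part stays above `m / 2`.
    obtain ⟨ξ, hξ⟩ : ∃ ξ, ξ = min (1 / 2) (ρ / (2 * (R + |c₀|))) := ⟨_, rfl⟩
    have hξ0 : 0 < ξ := by rw [hξ]; positivity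
    have hξ1 : ξ ≤ 1 / 2 := hξ ▸ min_le_left _ _
    have hξ2 : ξ * (R + |c₀|) ≤ ρ / 2 := by
      have : ξ ≤ ρ / (2 * (R + |c₀|)) := hξ ▸ min_le_right _ _
      rw [le_div_iff₀ (by positivity)] at this
      linarith
    obtain ⟨δ, hδ, hexp⟩ := Metric.continuousAt_iff.1
      (Real.continuous_exp.continuousAt (x := 0)) ξ hξ0
    obtain ⟨κ, hκ⟩ : ∃ κ, κ = ε * m / (4 * (A + 1)) := ⟨_, rfl⟩
    have hκ0 : 0 < κ := by rw [hκ]; positivity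
    have hκA : A * (κ / (m / 2)) ≤ ε / 2 := by
      have : A * (κ / (m / 2)) = ε / 2 * (A / (A + 1)) := by
        rw [hκ]
        field_simp
        ring
      rw [this]
      exact mul_le_of_le_one_right (by positivity) ((div_le_one (by positivity)).2 (by linarith))
    have key : ∀ s r c (w : ℍ), ∃ u : ℂ,
        u = (Real.exp (-r) : ℝ) * ((hyperbolicFlow s c w : ℂ) + c₀) - c₀ ∧
        u + c₀ = (Real.exp (s - r) : ℝ) * (w + c₀ + ((c - c₀) * (1 - Real.exp (-s)) : ℝ)) ∧
        u.im = Real.exp (s - r) * (w : ℂ).im := by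
      intro s r c w
      refine ⟨_, rfl, ?_, ?_⟩
      · rw [sub_add_cancel, exp_neg_mul_hyperbolicFlow]
      · rw [im_exp_mul_sub, coe_hyperbolicFlow, im_exp_mul_sub, ← mul_assoc, ← Real.exp_add,
          neg_add_eq_sub]
    have hdisp : ∀ s c, 0 ≤ s → c ∈ Metric.ball c₀ (ρ / 4) →
        ‖(((c - c₀) * (1 - Real.exp (-s)) : ℝ) : ℂ)‖ ≤ |c - c₀| := by
      intro s c hs _
      have h1 := Real.exp_le_one_iff.2 (neg_nonpos.2 hs)
      have h2 := Real.exp_pos (-s)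
      rw [Complex.norm_real, norm_mul, Real.norm_eq_abs, Real.norm_of_nonneg (by linarith)]
      exact mul_le_of_le_one_right (abs_nonneg _) (by linarith)
    refine ⟨δ / 2, by positivity, Metric.ball c₀ (ρ / 4), Metric.ball_mem_nhds _ (by positivity),
      fun r w => vanishingAt g c₀ κ ((Real.exp (-r) : ℝ) * (w + c₀) - c₀),
      fun r => (differentiableOn_vanishingAt hg hκ0).comp (by fun_prop) fun w hw => ?_, ?_, ?_⟩
    · change 0 < ((Real.exp (-r) : ℝ) * (w + c₀) - c₀ : ℂ).im
      rw [im_exp_mul_sub]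
      exact mul_pos (Real.exp_pos _) hw
    · intro s r hs hr hsr c hc w hw
      dsimp only
      obtain ⟨u, hu, hu1, hu2⟩ := key s r c w
      rw [← hu]
      obtain ⟨hwm, hwR⟩ := hKb w hw
      have hE := hexp (x := s - r) (by rw [Real.dist_eq, sub_zero]; linarith)
      rw [Real.exp_zero, Real.dist_eq] at hE
      obtain ⟨hE1, hE2⟩ := abs_lt.1 hE
      have hd := hdisp s c hs hc
      rw [Metric.mem_ball, Real.dist_eq] at hc
      have hum : m / 2 ≤ u.im := by rw [hu2]; nlinarith
      have hdist : ‖u - w‖ < ρ := by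
        have : u - w = ((Real.exp (s - r) - 1 : ℝ) : ℂ) * (w + c₀) +
            (Real.exp (s - r) : ℝ) * (((c - c₀) * (1 - Real.exp (-s)) : ℝ) : ℂ) := by
          rw [eq_sub_of_add_eq hu1, Complex.ofReal_sub, Complex.ofReal_one]
          ring
        rw [this]
        refine (norm_add_le _ _).trans_lt ?_
        rw [norm_mul, norm_mul, Complex.norm_real, Complex.norm_real, Real.norm_eq_abs,
          Real.norm_of_nonneg (Real.exp_pos _).le]
        have h1 : ‖(w : ℂ) + c₀‖ ≤ R + |c₀| :=
          (norm_add_le _ _).trans (by rw [Complex.norm_real, Real.norm_eq_abs]; linarith)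
        have h2 := mul_le_mul hE.le h1 (norm_nonneg _) hξ0.le
        have h3 := mul_le_mul (by linarith : Real.exp (s - r) ≤ 3 / 2) hd (norm_nonneg _)
          (by norm_num)
        linarith
      have hu0 : 0 < u.im := by linarith
      have e1 := hgρ w hw u hdist
      have e2 : ‖vanishingAt g c₀ κ u - g u‖ ≤ ε / 2 := by
        refine (norm_vanishingAt_sub_le hκ0 hu0).trans (le_trans ?_ hκA)
        have := (hgA' u hu0).1
        gcongr
      calc _ ≤ _ := norm_sub_le_norm_sub_add_norm_sub _ (g u) _
        _ ≤ _ := by linarith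
    · intro K' hK'
      obtain ⟨m', hm', R', hR', hKb'⟩ := UpperHalfPlane.exists_bounds_of_isCompact hK'
      obtain ⟨D, hD⟩ : ∃ D, D = R' + |c₀| + ρ / 4 := ⟨_, rfl⟩
      have hD0 : 0 < D := by rw [hD]; positivity
      refine ⟨2 * (A * D / κ) + 2 * (A / m'), fun s r hs hr hsr c hc w hw => ?_⟩
      dsimp only
      obtain ⟨u, hu, hu1, hu2⟩ := key s r c w
      rw [← hu]
      obtain ⟨hwm, hwR⟩ := hKb' w hw
      have hd := hdisp s c hs hc
      rw [Metric.mem_ball, Real.dist_eq] at hc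
      have hu0 : 0 < u.im := hu2 ▸ mul_pos (Real.exp_pos _) w.coe_im_pos
      have hp1 : 0 ≤ A * D / κ := by positivity
      have hp2 : 0 ≤ A / m' := by positivity
      have hsr2 : 0 < (s - r) ^ 2 := by
        have := sub_ne_zero.2 hsr
        positivity
      -- For `s < r` the point `u` is contracted towards `-c₀`, where the extra factor vanishes; for
      -- `s > r` its imaginary part grows exponentially and `g` decays.
      rcases lt_or_gt_of_ne hsr with hlt | hgt
      · have hx := Real.exp_neg_le_two_div_sq (sub_pos.2 hlt)
        rw [neg_sub] at hx
        have h1 : ‖u + c₀‖ ≤ Real.exp (s - r) * D := by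
          rw [hu1, norm_mul, Complex.norm_real, Real.norm_of_nonneg (Real.exp_pos _).le]
          gcongr
          refine (norm_add₃_le ..).trans ?_
          rw [Complex.norm_real c₀, Real.norm_eq_abs]
          linarith
        calc _ ≤ ‖g u‖ * (‖u + c₀‖ / κ) := norm_vanishingAt_le_mul_div hκ0 hu0
          _ ≤ A * (Real.exp (s - r) * D / κ) := by
            have := (hgA' u hu0).1
            gcongr
          _ = A * D / κ * Real.exp (s - r) := by ring
          _ ≤ A * D / κ * (2 / (r - s) ^ 2) := by gcongr
          _ = 2 * (A * D / κ) / (s - r) ^ 2 := by rw [← neg_sub s r, neg_sq]; ring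
          _ ≤ _ := by gcongr; linarith
      · have hx := Real.exp_neg_le_two_div_sq (sub_pos.2 hgt)
        calc _ ≤ ‖g u‖ := norm_vanishingAt_le hκ0 hu0
          _ ≤ A / u.im := (hgA' u hu0).2
          _ ≤ A / (Real.exp (s - r) * m') := by rw [hu2]; gcongr
          _ = A / m' * Real.exp (-(s - r)) := by rw [Real.exp_neg]; field_simp
          _ ≤ A / m' * (2 / (s - r) ^ 2) := by gcongr
          _ = 2 * (A / m') / (s - r) ^ 2 := by ring
          _ ≤ _ := by gcongr; linarith

/-! ### Automorphisms of the disc as affine maps -/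

open scoped ComplexConjugate

theorem one_sub_conj_mul_ne_zero {α z : ℂ} (hα : ‖α‖ < 1) (hz : ‖z‖ ≤ 1) :
    1 - conj α * z ≠ 0 := by
  intro h
  have h1 : ‖conj α * z‖ = 1 := by rw [← sub_eq_zero.1 h, norm_one]
  rw [norm_mul, Complex.norm_conj] at h1
  nlinarith [norm_nonneg α, norm_nonneg z]

/-- The squares differ by `(1 - |α|²)(1 - |z|²)`. -/
theorem norm_sub_lt_norm_one_sub_conj_mul {α z : ℂ} (hα : ‖α‖ < 1) (hz : ‖z‖ < 1) :
    ‖α - z‖ < ‖1 - conj α * z‖ := by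
  have hα' : Complex.normSq α < 1 := by
    rw [Complex.normSq_eq_norm_sq]; exact pow_lt_one₀ (norm_nonneg _) hα two_ne_zero
  have hz' : Complex.normSq z < 1 := by
    rw [Complex.normSq_eq_norm_sq]; exact pow_lt_one₀ (norm_nonneg _) hz two_ne_zero
  rw [← sq_lt_sq₀ (norm_nonneg _) (norm_nonneg _), ← Complex.normSq_eq_norm_sq,
    ← Complex.normSq_eq_norm_sq]
  rw [Complex.normSq_apply] at hα' hz' ⊢
  rw [Complex.normSq_apply]
  simp only [Complex.sub_re, Complex.sub_im, Complex.mul_re, Complex.mul_im, Complex.conj_re,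
    Complex.conj_im, Complex.one_re, Complex.one_im]
  nlinarith [mul_pos (sub_pos.2 hα') (sub_pos.2 hz')]

/-- The holomorphic involution of the disc that exchanges `0` and `α`. -/
noncomputable def discInvolution (α z : 𝔻) : 𝔻 :=
  Complex.UnitDisc.mk ((α - z) / (1 - conj (α : ℂ) * z)) (by
    have h := norm_sub_lt_norm_one_sub_conj_mul α.norm_lt_one z.norm_lt_one
    rw [norm_div]
    exact (div_lt_one ((norm_nonneg _).trans_lt h)).2 h)

theorem coe_discInvolution (α z : 𝔻) :
    (discInvolution α z : ℂ) = (α - z) / (1 - conj (α : ℂ) * z) := rfl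

theorem discInvolution_zero (α : 𝔻) : discInvolution α 0 = α := by
  rw [← Complex.UnitDisc.coe_inj, coe_discInvolution]
  simp

theorem discInvolution_self (α : 𝔻) : discInvolution α α = 0 := by
  rw [← Complex.UnitDisc.coe_inj, coe_discInvolution]
  simp

theorem discInvolution_discInvolution (α z : 𝔻) : discInvolution α (discInvolution α z) = z := by
  have h1 := one_sub_conj_mul_ne_zero α.norm_lt_one z.norm_lt_one.le
  have h2 := one_sub_conj_mul_ne_zero α.norm_lt_one (discInvolution α z).norm_lt_one.le
  rw [← Complex.UnitDisc.coe_inj, coe_discInvolution, div_eq_iff h2, coe_discInvolution]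
  obtain ⟨d, hd⟩ : ∃ d, d = 1 - conj (α : ℂ) * z := ⟨_, rfl⟩
  rw [← hd] at h1 ⊢
  field_simp
  rw [hd]
  ring

theorem isHolomorphicOnDisc_discInvolution (α : 𝔻) :
    IsHolomorphicOnDisc fun z => (discInvolution α z : ℂ) := by
  have h1 : Differentiable ℂ fun z : ℂ => (α : ℂ) - z := by fun_prop
  have h2 : Differentiable ℂ fun z : ℂ => 1 - conj (α : ℂ) * z := by fun_prop
  exact ⟨_, h1.differentiableOn.div h2.differentiableOn fun z hz =>
    one_sub_conj_mul_ne_zero α.norm_lt_one (mem_ball_zero_iff.1 hz).le, fun z => rfl⟩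

theorem mapsTo_ball_of_forall_eq {F : ℂ → ℂ} {G : 𝔻 → 𝔻} (hFG : ∀ z : 𝔻, F z = G z) :
    Set.MapsTo F (Metric.ball 0 1) (Metric.closedBall 0 1) := fun z hz => by
  obtain ⟨w, rfl⟩ := HolDisc.exists_unitDisc_eq hz
  rw [hFG, mem_closedBall_zero_iff]
  exact (G w).norm_lt_one.le

theorem IsHolomorphicOnDisc.norm_le_of_map_zero {G : 𝔻 → 𝔻}
    (hG : IsHolomorphicOnDisc fun z => (G z : ℂ)) (h0 : G 0 = 0) (z : 𝔻) :
    ‖(G z : ℂ)‖ ≤ ‖(z : ℂ)‖ := by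
  obtain ⟨F, hF, hFG⟩ := hG
  dsimp only at hFG
  rw [← hFG]
  refine Complex.norm_le_norm_of_mapsTo_ball hF (mapsTo_ball_of_forall_eq hFG) ?_ z.norm_lt_one
  rw [← Complex.UnitDisc.coe_zero, hFG, h0]

/-- Every automorphism of the disc is a Möbius transformation. -/
theorem DiscAut.exists_eq_mul_discInvolution (φ : DiscAut) :
    ∃ (α : 𝔻) (c : ℂ), ∀ z, (φ.toHomeomorph z : ℂ) = c * discInvolution α z := by
  obtain ⟨α, hα⟩ : ∃ α, φ.toHomeomorph.symm 0 = α := ⟨_, rfl⟩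
  have hφα : φ.toHomeomorph α = 0 := by rw [← hα, Homeomorph.apply_symm_apply]
  have hG := φ.holomorphic.comp (isHolomorphicOnDisc_discInvolution α)
  have hH := (isHolomorphicOnDisc_discInvolution α).comp φ.holomorphic_symm
  have hG0 : φ.toHomeomorph (discInvolution α 0) = 0 := by rw [discInvolution_zero, hφα]
  have hH0 : discInvolution α (φ.toHomeomorph.symm 0) = 0 := by rw [hα, discInvolution_self]
  -- The Schwarz lemma for this map and for its inverse. Equality at the single point `1 / 2` then
  -- forces the map to be linear.
  have hnorm : ∀ z : 𝔻, ‖(φ.toHomeomorph (discInvolution α z) : ℂ)‖ = ‖(z : ℂ)‖ := by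
    intro z
    refine le_antisymm (IsHolomorphicOnDisc.norm_le_of_map_zero
      (G := fun z => φ.toHomeomorph (discInvolution α z)) hG hG0 z) ?_
    have := IsHolomorphicOnDisc.norm_le_of_map_zero
      (G := fun z => discInvolution α (φ.toHomeomorph.symm z)) hH hH0
      (φ.toHomeomorph (discInvolution α z))
    simpa only [Homeomorph.symm_apply_apply, discInvolution_discInvolution] using this
  obtain ⟨F, hF, hFG⟩ := hG
  dsimp only at hFG
  have hF0 : F 0 = 0 := by rw [← Complex.UnitDisc.coe_zero, hFG, hG0]
  obtain ⟨z₁, hz₁⟩ := HolDisc.exists_unitDisc_eq (z := 1 / 2)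
    (by rw [mem_ball_zero_iff]; norm_num)
  have hmem : (z₁ : ℂ) ∈ Metric.ball (0 : ℂ) 1 := mem_ball_zero_iff.2 z₁.norm_lt_one
  have hne : (z₁ : ℂ) ≠ 0 := by rw [hz₁]; norm_num
  have haff := Complex.affine_of_mapsTo_ball_of_norm_dslope_eq_div hF
    (by rw [hF0]; exact mapsTo_ball_of_forall_eq hFG) hmem (by
      rw [dslope_of_ne _ hne, slope_def_field, hF0, sub_zero, sub_zero, norm_div, hFG, hnorm,
        div_self (norm_ne_zero_iff.2 hne), div_one])
  refine ⟨α, dslope F 0 z₁, fun z => ?_⟩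
  have h1 := haff (mem_ball_zero_iff.2 (discInvolution α z).norm_lt_one)
  simp only [hF0, sub_zero, zero_add, smul_eq_mul, hFG, discInvolution_discInvolution] at h1
  rw [h1, mul_comm]

instance neBot_comap_coe_nhds_circle (ω : Circle) :
    (comap (fun z : 𝔻 => (z : ℂ)) (𝓝 (ω : ℂ))).NeBot := by
  rw [comap_neBot_iff_frequently]
  have : (ω : ℂ) ∈ closure (Metric.ball (0 : ℂ) 1) := by
    rw [closure_ball _ one_ne_zero, mem_closedBall_zero_iff, ω.norm_coe]
  refine (mem_closure_iff_frequently.1 this).mono fun z hz => ?_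
  obtain ⟨w, rfl⟩ := HolDisc.exists_unitDisc_eq hz
  exact ⟨w, rfl⟩

/-- In the upper half-plane model, an automorphism that fixes infinity is an affine map. -/
theorem DiscAut.exists_cayley_eq_affine (φ : DiscAut) {ω : Circle}
    (hφ : Tendsto (fun z : 𝔻 => (φ.toHomeomorph z : ℂ))
      (comap (fun z : 𝔻 => (z : ℂ)) (𝓝 (ω : ℂ))) (𝓝 (ω : ℂ))) :
    ∃ a > (0 : ℝ), ∃ b : ℝ, ∀ z, (cayley ω (φ.toHomeomorph z) : ℂ) = a * cayley ω z + b := by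
  obtain ⟨α, c, hc⟩ := φ.exists_eq_mul_discInvolution
  have hω0 : (ω : ℂ) ≠ 0 := ω.coe_ne_zero
  have hαω := one_sub_conj_mul_ne_zero α.norm_lt_one ω.norm_coe.le
  have hωω : (ω : ℂ) * conj (ω : ℂ) = 1 := by
    rw [Complex.mul_conj, Complex.normSq_eq_norm_sq, ω.norm_coe]; norm_num
  -- The Möbius formula is continuous at `ω`, so its value there is the boundary limit `ω`.
  have hfix : c * (α - ω) = ω * (1 - conj (α : ℂ) * ω) := by
    rw [← div_eq_iff hαω, mul_div_assoc]
    refine tendsto_nhds_unique ?_ hφ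
    simp only [hc, coe_discInvolution]
    have : ContinuousAt (fun z : ℂ => c * ((α - z) / (1 - conj (α : ℂ) * z))) ω :=
      continuousAt_const.mul (ContinuousAt.div (by fun_prop) (by fun_prop) hαω)
    exact this.tendsto.comp tendsto_comap
  have hc0 : c ≠ 0 := by
    rintro rfl
    rw [zero_mul] at hfix
    exact mul_ne_zero hω0 hαω hfix.symm
  have hα1 : (0 : ℝ) < 1 - Complex.normSq α := by linarith [α.normSq_lt_one]
  have hα2 : (1 : ℂ) - α * conj (α : ℂ) = ((1 - Complex.normSq α : ℝ) : ℂ) := by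
    rw [Complex.mul_conj]; push_cast; rfl
  have hα3 : (1 : ℂ) - α * conj (α : ℂ) ≠ 0 := by
    rw [hα2]; exact Complex.ofReal_ne_zero.2 hα1.ne'
  obtain ⟨a, ha⟩ : ∃ a : ℝ, a = Complex.normSq (1 - conj (α : ℂ) * ω) / (1 - Complex.normSq α) :=
    ⟨_, rfl⟩
  have ha0 : 0 < a := by
    rw [ha]; exact div_pos (Complex.normSq_pos.2 hαω) hα1
  have hac : (a : ℂ) = -(1 - conj (α : ℂ) * ω) ^ 2 / (c * (1 - α * conj (α : ℂ))) := by
    rw [ha, Complex.ofReal_div, ← hα2, ← Complex.mul_conj, div_eq_div_iff hα3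
      (mul_ne_zero hc0 hα3)]
    simp only [map_sub, map_one, map_mul, Complex.conj_conj]
    have h1 : c * (1 - α * conj (ω : ℂ)) = -(1 - conj (α : ℂ) * ω) := by
      apply mul_left_cancel₀ hω0
      linear_combination (-c * α) * hωω - hfix
    linear_combination (1 - conj (α : ℂ) * ω) * (1 - α * conj (α : ℂ)) * h1
  obtain ⟨b, hb⟩ : ∃ b : ℂ, b = Complex.I * (a - 1 -
      2 * ω * conj (α : ℂ) * (1 - conj (α : ℂ) * ω) / (c * (1 - α * conj (α : ℂ)))) := ⟨_, rfl⟩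
  have haffine : ∀ z, (cayley ω (φ.toHomeomorph z) : ℂ) = a * cayley ω z + b := by
    intro z
    have hz := one_sub_conj_mul_ne_zero α.norm_lt_one z.norm_lt_one.le
    have hωz := Complex.UnitDisc.circle_sub_ne_zero ω z.norm_lt_one
    obtain ⟨d, hd⟩ : ∃ d, d = 1 - conj (α : ℂ) * z := ⟨_, rfl⟩
    obtain ⟨e, he⟩ : ∃ e, e = 1 - conj (α : ℂ) * ω := ⟨_, rfl⟩
    rw [← he] at hαω hac hb hfix
    rw [← hd] at hz
    -- The factor `ω - z` appears because `ω` is fixed; hence the Cayley image has no pole other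
    -- than infinity and is affine.
    have hsub : (ω : ℂ) - φ.toHomeomorph z = -c * ((1 - α * conj (α : ℂ)) * (ω - z)) /
        (e * d) := by
      have h1 : (ω : ℂ) = c * (α - ω) / e := by
        rw [hfix, mul_div_cancel_right₀ _ hαω]
      rw [hc, coe_discInvolution, ← hd]
      nth_rewrite 1 [h1]
      field_simp
      rw [hd, he]
      ring
    have hI : ∀ w : 𝔻, (cayley ω w : ℂ) = 2 * Complex.I * ω / (ω - w) - Complex.I := by
      intro w
      rw [← cayley_add_I (Complex.UnitDisc.circle_sub_ne_zero ω w.norm_lt_one), coe_cayley,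
        add_sub_cancel_right]
    obtain ⟨f, hf⟩ : ∃ f : ℂ, f = 1 - α * conj (α : ℂ) := ⟨_, rfl⟩
    obtain ⟨k, hk⟩ : ∃ k : ℂ, k = ω - z := ⟨_, rfl⟩
    rw [hI, hI, hsub, hb, hac]
    rw [← hf] at hα3 ⊢
    rw [← hk] at hωz ⊢
    field_simp
    rw [show d = e + conj (α : ℂ) * k by rw [hd, he, hk]; ring]
    ring
  have him : ∀ z, (cayley ω (φ.toHomeomorph z) : ℂ).im = a * (cayley ω z : ℂ).im + b.im := by
    intro z
    rw [haffine, Complex.add_im, Complex.im_ofReal_mul]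
  have hsurj : ∀ y : ℝ, 0 < y → ∃ z, (cayley ω z : ℂ).im = y := by
    intro y hy
    refine ⟨(cayley ω).symm ⟨y * Complex.I, by simpa using hy⟩, ?_⟩
    rw [Homeomorph.apply_symm_apply]
    simp
  -- A negative imaginary part would push a point onto the real axis; a positive one would leave low
  -- points uncovered, against surjectivity.
  have hb0 : b.im = 0 := by
    rcases lt_trichotomy b.im 0 with hneg | h0 | hpos
    · obtain ⟨z, hz⟩ := hsurj (-b.im / a) (div_pos (neg_pos.2 hneg) ha0)
      have h1 := (cayley ω (φ.toHomeomorph z)).coe_im_pos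
      rw [him, hz, mul_div_cancel₀ _ ha0.ne', neg_add_cancel] at h1
      exact absurd h1 (lt_irrefl _)
    · exact h0
    · obtain ⟨z, hz⟩ := hsurj b.im hpos
      have h1 := him (φ.toHomeomorph.symm z)
      rw [Homeomorph.apply_symm_apply, hz] at h1
      have h2 := mul_pos ha0 (cayley ω (φ.toHomeomorph.symm z)).coe_im_pos
      linarith
  refine ⟨a, ha0, b.re, fun z => ?_⟩
  rw [haffine]
  congr 1
  exact Complex.ext (by simp) (by simp [hb0])

/-! ### Iterates as flow times, and the conclusion -/

theorem DiscAut.compOp_pow_apply (φ : DiscAut) (n : ℕ) (f : HolDisc) (z : 𝔻) :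
    ((φ.compOp ^ n) f).1 z = f.1 (φ.toHomeomorph^[n] z) := by
  induction n generalizing f with
  | zero => rfl
  | succ n ih =>
    rw [pow_succ, Function.iterate_succ_apply']
    exact ih (φ.compOp f)

theorem DiscAut.mem_hypercyclicVectors_of_flow {φ : DiscAut} {ω : Circle} {f : HolDisc}
    {Ψ : ℕ → ℍ → ℍ}
    (hf : Dense {y : HolDisc | ∃ n : ℕ, 1 ≤ n ∧
      ∀ z, y.1 z = f.1 ((cayley ω).symm (Ψ n (cayley ω z)))})
    (hΨ : ∀ n z, (cayley ω (φ.toHomeomorph^[n] z) : ℂ) = Ψ n (cayley ω z)) :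
    f ∈ hypercyclicVectors φ.compOp := by
  refine hf.mono ?_
  rintro y ⟨n, hn, hy⟩
  refine ⟨n, hn, Subtype.ext (ContinuousMap.ext fun z => ?_)⟩
  rw [hy, DiscAut.compOp_pow_apply, ← UpperHalfPlane.ext (hΨ n z), Homeomorph.symm_apply_apply]

theorem cayley_iterate_of_add {ω : Circle} {φ : 𝔻 → 𝔻} {b : ℝ}
    (h : ∀ z, (cayley ω (φ z) : ℂ) = cayley ω z + b) (n : ℕ) (z : 𝔻) :
    (cayley ω (φ^[n] z) : ℂ) = cayley ω z + ((n * b : ℝ) : ℂ) := by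
  induction n with
  | zero => simp
  | succ n ih =>
    rw [Function.iterate_succ_apply', h, ih]
    push_cast
    ring

/-- The affine map fixes `-b / (a - 1)` and is the dilation by `a` about it. -/
theorem cayley_iterate_of_affine {ω : Circle} {φ : 𝔻 → 𝔻} {a b : ℝ} (ha : a ≠ 1)
    (h : ∀ z, (cayley ω (φ z) : ℂ) = a * cayley ω z + b) (n : ℕ) (z : 𝔻) :
    (cayley ω (φ^[n] z) : ℂ) =
      ((a ^ n : ℝ) : ℂ) * (cayley ω z + ((b / (a - 1) : ℝ) : ℂ)) - ((b / (a - 1) : ℝ) : ℂ) := by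
  obtain ⟨c, hc⟩ : ∃ c, c = b / (a - 1) := ⟨_, rfl⟩
  have hb : (b : ℂ) = c * (a - 1) := by
    rw [hc]
    exact_mod_cast (div_mul_cancel₀ b (sub_ne_zero.2 ha)).symm
  rw [← hc]
  induction n with
  | zero => simp
  | succ n ih =>
    rw [Function.iterate_succ_apply', h, ih, hb]
    push_cast
    ring

/-- Rules out the identity and the contractions `a < 1`, whose half-plane orbits are bounded. -/
theorem not_tendsto_of_norm_cayley_add_I_le {ω : Circle} {u : ℕ → 𝔻} {C : ℝ}
    (h : ∀ n, ‖(cayley ω (u n) : ℂ) + Complex.I‖ ≤ C) :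
    ¬ Tendsto (fun n => (u n : ℂ)) atTop (𝓝 (ω : ℂ)) := by
  intro hu
  have h1 : Tendsto (fun n => C * ‖(ω : ℂ) - u n‖) atTop (𝓝 (C * ‖(ω : ℂ) - ω‖)) :=
    (hu.const_sub _).norm.const_mul C
  have h2 : (2 : ℝ) ≤ C * ‖(ω : ℂ) - ω‖ := by
    refine ge_of_tendsto' h1 fun n => ?_
    rw [← norm_cayley_add_I ω (u n)]
    exact mul_le_mul_of_nonneg_right (h n) (norm_nonneg _)
  rw [sub_self, norm_zero, mul_zero] at h2
  linarith

theorem commonHypercyclicVectors_mem_residual (ω : Circle) :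
    commonHypercyclicVectors ω ∈ residual HolDisc := by
  filter_upwards [hyperbolicFlow_dense_mem_residual ω,
    parabolicFlow_dense_mem_residual ω (σ := 1) abs_one,
    parabolicFlow_dense_mem_residual ω (σ := -1) (by rw [abs_neg, abs_one])]
    with f hhyp hpos hneg
  rintro φ ⟨hfix, hiter⟩
  obtain ⟨a, ha, b, hab⟩ := φ.exists_cayley_eq_affine hfix
  rcases eq_or_ne a 1 with rfl | ha1
  · simp only [Complex.ofReal_one, one_mul] at hab
    have hn := cayley_iterate_of_add hab
    rcases lt_trichotomy b 0 with hb | rfl | hb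
    · refine DiscAut.mem_hypercyclicVectors_of_flow (hneg (-b) (neg_pos.2 hb) ()) fun n z => ?_
      rw [hn, coe_parabolicFlow]
      push_cast
      ring
    · refine absurd (hiter 0) (not_tendsto_of_norm_cayley_add_I_le
        (C := ‖(cayley ω 0 : ℂ) + Complex.I‖) fun n => ?_)
      rw [hn, mul_zero, Complex.ofReal_zero, add_zero]
    · refine DiscAut.mem_hypercyclicVectors_of_flow (hpos b hb ()) fun n z => ?_
      rw [hn, coe_parabolicFlow, one_mul]
  · have hn := cayley_iterate_of_affine ha1 hab
    rcases lt_or_gt_of_ne ha1 with hlt | hgt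
    · refine absurd (hiter 0) (not_tendsto_of_norm_cayley_add_I_le
        (C := ‖(cayley ω 0 : ℂ) + ((b / (a - 1) : ℝ) : ℂ)‖ + ‖((b / (a - 1) : ℝ) : ℂ)‖ + 1)
        fun n => ?_)
      rw [hn]
      refine (norm_add_le _ _).trans ?_
      rw [Complex.norm_I]
      refine add_le_add_left ((norm_sub_le _ _).trans (add_le_add_left ?_ _)) _
      rw [norm_mul, Complex.norm_real, Real.norm_of_nonneg (by positivity)]
      exact mul_le_of_le_one_left (norm_nonneg _) (pow_le_one₀ ha.le hlt.le)
    · refine DiscAut.mem_hypercyclicVectors_of_flow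
        (hhyp (Real.log a) (Real.log_pos hgt) (b / (a - 1))) fun n z => ?_
      rw [hn, coe_hyperbolicFlow, Real.exp_nat_mul, Real.exp_log ha]

theorem mainTheorem1 (ω : Circle) :
    (∃ f : HolDisc, ∀ φ : DiscAut, φ.HasAttractiveFixedPoint ω →
      f ∈ hypercyclicVectors φ.compOp) ∧
    commonHypercyclicVectors ω ∈ residual HolDisc :=
  ⟨(dense_of_mem_residual (commonHypercyclicVectors_mem_residual ω)).nonempty,
    commonHypercyclicVectors_mem_residual ω⟩
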